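/- All C*-algebras are complex, "homomorphism" means *-homomorphism, $\otimes$ is the minimal (spatial) C*-tensor product, and $M(B)$ is the multiplier algebra of $B$. A C*-bialgebra is a pair $(A,\Delta)$ of a C*-algebra $A$ and a homomorphism $\Delta:A\to M(A\otimes A)$ such that the linear span of $\{\Delta(a)(b\otimes c): a,b,c\in A\}$ is norm dense in $A\otimes A$ and $(\Delta\otimes \mathrm{id})\circ\Delta=(\mathrm{id}\otimes\Delta)\circ\Delta$ (with $\Delta\otimes\mathrm{id}$, $\mathrm{id}\otimes\Delta$ extended to $M(A\otimes A)$). It is strictly proper if $\Delta(a)\in A\otimes A$ for all $a\in A$, and counital with counit $\varepsilon$ if $\varepsilon:A\to\mathbb C$ is a homomorphism with $(\varepsilon\otimes \mathrm{id})\circ\Delta=\mathrm{id}=(\mathrm{id}\otimes\varepsilon)\circ\Delta$. Let $M$ be a monoid with unit $e$. A C*-weakly coassociative system over $M$ consists of unital C*-algebras $A_a$ ($a\in M$) and unital homomorphisms $\varphi_{a,b}:A_{ab}\to A_a\otimes A_b$ ($a,b\in M$) such that (i) $(\mathrm{id}_a\otimes\varphi_{b,c})\circ\varphi_{a,bc}=(\varphi_{a,b}\otimes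 \mathrm{id}_c)\circ\varphi_{ab,c}$ for all $a,b,c\in M$; (ii) there is a homomorphism $\varepsilon_e:A_e\to\mathbb C$ such that $(A_e,\varphi_{e,e},\varepsilon_e)$ is a counital C*-bialgebra; (iii) $(\varepsilon_e\otimes \mathrm{id}_a)\circ\varphi_{e,a}=\mathrm{id}_a=(\mathrm{id}_a\otimes\varepsilon_e)\circ\varphi_{a,e}$ for all $a\in M$. **Theorem 2.1.** Let $\{(A_a,\varphi_{a,b}): a,b\in M\}$ be a C*-weakly coassociative system over a monoid $M$, and suppose that for each $a\in M$ the set $\mathcal N_a=\{(b,c)\in M\times M: bc=a\}$ is finite. Let $A_*=\bigoplus_{a\in M}A_a$ be the C*-algebraic ($c_0$-) direct sum. Then there is a unique homomorphism $\Delta_\varphi: A_*\to A_*\otimes A_*$ with $\Delta_\varphi(x)=\sum_{(b,c)\in\mathcal N_a}\varphi_{b,c}(x)$ for all $a\in M$ and $x\in A_a$, where $A_b\otimes A_c$ is regarded as a subalgebra of $A_*\otimes A_*$. Let $\varepsilon:A_*\to\mathbb C$ be the homomorphism that equals $\varepsilon_e$ on $A_e$ and $0$ on $\bigoplus_{a\neq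 e}A_a$. Then $(A_*,\Delta_\varphi,\varepsilon)$ is a strictly proper counital C*-bialgebra. -/

import Mathlib

open TensorProduct
open scoped ENNReal Topology

universe u v w

noncomputable section

/-! ### The spatial norm on the algebraic tensor product -/

/-- A representation of the C*-algebra `A` on a complex Hilbert space (in the universe `w`). -/
structure HilbertRep (A : Type u) [NonUnitalCStarAlgebra A] : Type (max u (w + 1)) where
  space : Type w
  [normed : NormedAddCommGroup space]
  [inner : InnerProductSpace ℂ space]
  [complete : CompleteSpace space]
  rep : A →⋆ₙₐ[ℂ] (space →L[ℂ] space)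

attribute [instance] HilbertRep.normed HilbertRep.inner HilbertRep.complete

section Spatial

variable {A : Type u} {B : Type v} [NonUnitalCStarAlgebra A] [NonUnitalCStarAlgebra B]

/-- The representation `π ⊗ ρ` of the algebraic tensor product, on the algebraic tensor product of
the two Hilbert spaces with its inner product. This space is dense in the Hilbert space tensor
product, hence operator norms computed on it are those of the extended operators. -/
def tensorRep (π : HilbertRep.{u, w} A) (ρ : HilbertRep.{v, w} B) :
    A ⊗[ℂ] B →ₗ[ℂ] (π.space ⊗[ℂ] ρ.space →L[ℂ] π.space ⊗[ℂ] ρ.space) :=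
  TensorProduct.lift (LinearMap.mk₂ ℂ (fun a b => mapL (π.rep a) (ρ.rep b))
    (fun a a' b => by rw [map_add, mapL_add_left])
    (fun c a b => by rw [map_smul, mapL_smul_left])
    (fun a b b' => by rw [map_add, mapL_add_right])
    (fun c a b => by rw [map_smul, mapL_smul_right]))

theorem tensorRep_tmul (π : HilbertRep.{u, w} A) (ρ : HilbertRep.{v, w} B) (a : A) (b : B) :
    tensorRep π ρ (a ⊗ₜ b) = mapL (π.rep a) (ρ.rep b) := rfl

theorem tensorRep_mul (π : HilbertRep.{u, w} A) (ρ : HilbertRep.{v, w} B) (x y : A ⊗[ℂ] B) :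
    tensorRep π ρ (x * y) = tensorRep π ρ x * tensorRep π ρ y := by
  induction x with
  | zero => simp
  | add x x' h h' => rw [add_mul, map_add, map_add, h, h', add_mul]
  | tmul a b =>
    induction y with
    | zero => simp
    | add x x' h h' => rw [mul_add, map_add, map_add, h, h', mul_add]
    | tmul c d =>
      rw [Algebra.TensorProduct.tmul_mul_tmul, tensorRep_tmul, tensorRep_tmul, tensorRep_tmul,
        map_mul, map_mul, mapL_mul]

theorem inner_tensorRep_star (π : HilbertRep.{u, w} A) (ρ : HilbertRep.{v, w} B) (x : A ⊗[ℂ] B)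
    (s t : π.space ⊗[ℂ] ρ.space) :
    inner ℂ (tensorRep π ρ x s) t = inner ℂ s (tensorRep π ρ (star x) t) := by
  induction x with
  | zero => simp
  | add x x' h h' =>
    rw [star_add, map_add, map_add, add_apply, add_apply,
      inner_add_left, inner_add_right, h, h']
  | tmul a b =>
    induction s with
    | zero => simp
    | add s s' h h' => rw [map_add, inner_add_left, inner_add_left, h, h']
    | tmul s s' =>
      induction t with
      | zero => simp
      | add t t' h h' => rw [map_add, inner_add_right, inner_add_right, h, h']
      | tmul t t' =>
        rw [star_tmul, tensorRep_tmul, tensorRep_tmul, mapL_tmul, mapL_tmul, inner_tmul,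
          inner_tmul, map_star, map_star, ContinuousLinearMap.star_eq_adjoint,
          ContinuousLinearMap.star_eq_adjoint, ContinuousLinearMap.adjoint_inner_right,
          ContinuousLinearMap.adjoint_inner_right]

theorem norm_tensorRep_mul_self_le (π : HilbertRep.{u, w} A) (ρ : HilbertRep.{v, w} B)
    (x : A ⊗[ℂ] B) :
    ‖tensorRep π ρ x‖ * ‖tensorRep π ρ x‖ ≤ ‖tensorRep π ρ (star x * x)‖ := by
  have key : ‖tensorRep π ρ x‖ ≤ √‖tensorRep π ρ (star x * x)‖ := by
    refine ContinuousLinearMap.opNorm_le_bound _ (Real.sqrt_nonneg _) fun s => ?_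
    refine abs_le_of_sq_le_sq' ?_ (by positivity) |>.2
    rw [mul_pow, Real.sq_sqrt (ContinuousLinearMap.opNorm_nonneg _), ← inner_self_eq_norm_sq (𝕜 := ℂ),
      inner_tensorRep_star, ← mul_apply_eq_comp, ← tensorRep_mul]
    calc _ ≤ ‖s‖ * ‖tensorRep π ρ (star x * x) s‖ := re_inner_le_norm _ _
      _ ≤ ‖s‖ * (‖tensorRep π ρ (star x * x)‖ * ‖s‖) := by
        gcongr; exact ContinuousLinearMap.le_opNorm _ _
      _ = _ := by ring
  calc _ ≤ √‖tensorRep π ρ (star x * x)‖ * √‖tensorRep π ρ (star x * x)‖ := by gcongr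
    _ = _ := Real.mul_self_sqrt (ContinuousLinearMap.opNorm_nonneg _)

/-- The spatial (minimal) norm `sup ‖(π ⊗ ρ)(x)‖`, over all representations `π` of `A` and `ρ` of
`B` on Hilbert spaces in the universe `w`. If `w` is at least as large as the universes of `A` and
`B`, then all cyclic representations occur up to unitary equivalence. -/
def spatialNorm (x : A ⊗[ℂ] B) : ℝ :=
  ⨆ p : HilbertRep.{u, w} A × HilbertRep.{v, w} B, ‖tensorRep p.1 p.2 x‖

instance : Nonempty (HilbertRep.{u, w} A) := ⟨⟨PUnit, 0⟩⟩

theorem bddAbove_tensorRep (x : A ⊗[ℂ] B) :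
    BddAbove (Set.range fun p : HilbertRep.{u, w} A × HilbertRep.{v, w} B =>
      ‖tensorRep p.1 p.2 x‖) := by
  induction x with
  | zero => exact ⟨0, by rintro _ ⟨p, rfl⟩; simp only [map_zero]; exact ContinuousLinearMap.opNorm_zero.le⟩
  | add x y hx hy =>
    obtain ⟨c, hc⟩ := hx
    obtain ⟨d, hd⟩ := hy
    refine ⟨c + d, ?_⟩
    rintro _ ⟨p, rfl⟩
    have h1 := hc ⟨p, rfl⟩
    have h2 := hd ⟨p, rfl⟩
    simp only [map_add] at *
    exact (ContinuousLinearMap.opNorm_add_le _ _).trans (add_le_add h1 h2)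
  | tmul a b =>
    refine ⟨‖a‖ * ‖b‖, ?_⟩
    rintro _ ⟨p, rfl⟩
    refine (norm_mapL_le _ _).trans ?_
    gcongr
    · exact NonUnitalStarAlgHom.norm_apply_le _ _
    · exact NonUnitalStarAlgHom.norm_apply_le _ _

theorem le_spatialNorm (π : HilbertRep.{u, w} A) (ρ : HilbertRep.{v, w} B) (x : A ⊗[ℂ] B) :
    ‖tensorRep π ρ x‖ ≤ spatialNorm.{u, v, w} x :=
  le_ciSup (bddAbove_tensorRep x) (π, ρ)

theorem spatialNorm_le {x : A ⊗[ℂ] B} {c : ℝ}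
    (h : ∀ (π : HilbertRep.{u, w} A) (ρ : HilbertRep.{v, w} B), ‖tensorRep π ρ x‖ ≤ c) :
    spatialNorm.{u, v, w} x ≤ c :=
  ciSup_le fun p => h p.1 p.2

theorem spatialNorm_nonneg (x : A ⊗[ℂ] B) : 0 ≤ spatialNorm.{u, v, w} x :=
  Real.iSup_nonneg fun _ => ContinuousLinearMap.opNorm_nonneg _

end Spatial


/-! ### Completion of a *-algebra in a C*-seminorm -/

/-- A C*-seminorm on a complex *-algebra: a submultiplicative seminorm with
`p x ^ 2 ≤ p (x* x)` (hence `p (x* x) = p x ^ 2`). -/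
structure CStarSeminorm (R : Type u) [NonUnitalRing R] [Module ℂ R] [Star R] where
  toFun : R → ℝ
  apply_zero : toFun 0 = 0
  add_le : ∀ x y, toFun (x + y) ≤ toFun x + toFun y
  smul_le : ∀ (c : ℂ) x, toFun (c • x) ≤ ‖c‖ * toFun x
  mul_le : ∀ x y, toFun (x * y) ≤ toFun x * toFun y
  nonneg : ∀ x, 0 ≤ toFun x
  mul_self_le : ∀ x, toFun x * toFun x ≤ toFun (star x * x)

namespace CStarSeminorm

variable {R : Type u} [NonUnitalRing R] [Module ℂ R] [StarRing R]

theorem apply_star (p : CStarSeminorm R) (x : R) : p.toFun (star x) = p.toFun x := by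
  have key : ∀ y : R, p.toFun y ≤ p.toFun (star y) := by
    intro y
    by_contra! h
    have h0 : 0 < p.toFun y := (p.nonneg _).trans_lt h
    have h1 := (p.mul_self_le y).trans (p.mul_le (star y) y)
    exact absurd (le_of_mul_le_mul_right h1 h0) (not_le.2 h)
  refine le_antisymm ?_ (key x)
  simpa using key (star x)

theorem apply_neg (p : CStarSeminorm R) (x : R) : p.toFun (-x) = p.toFun x := by
  have key : ∀ y : R, p.toFun (-y) ≤ p.toFun y := fun y => by
    simpa using p.smul_le (-1) y
  refine le_antisymm (key x) ?_
  simpa using key (-x)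

/-- The *-algebra `R`, seen as a seminormed algebra through `p`. -/
def Alg (_p : CStarSeminorm R) : Type u := R

variable (p : CStarSeminorm R)

instance : NonUnitalRing p.Alg := inferInstanceAs (NonUnitalRing R)
instance : Module ℂ p.Alg := inferInstanceAs (Module ℂ R)
instance : StarRing p.Alg := inferInstanceAs (StarRing R)
instance [IsScalarTower ℂ R R] : IsScalarTower ℂ p.Alg p.Alg :=
  inferInstanceAs (IsScalarTower ℂ R R)
instance [SMulCommClass ℂ R R] : SMulCommClass ℂ p.Alg p.Alg :=
  inferInstanceAs (SMulCommClass ℂ R R)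
instance [StarModule ℂ R] : StarModule ℂ p.Alg := inferInstanceAs (StarModule ℂ R)

/-- `p` as a seminorm of additive groups. -/
def groupSeminorm : AddGroupSeminorm p.Alg where
  toFun := p.toFun
  map_zero' := p.apply_zero
  add_le' := p.add_le
  neg' := p.apply_neg

instance : SeminormedAddCommGroup p.Alg := p.groupSeminorm.toSeminormedAddCommGroup

instance : NonUnitalSeminormedRing p.Alg where
  __ := (inferInstance : SeminormedAddCommGroup p.Alg)
  __ := (inferInstance : NonUnitalRing p.Alg)
  norm_mul_le := p.mul_le

instance : NormedSpace ℂ p.Alg where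
  norm_smul_le := p.smul_le

instance : NormedStarGroup p.Alg where
  norm_star_le := fun x => (p.apply_star x).le

/-- The Hausdorff completion of `R` in the C*-seminorm `p`. -/
def Compl : Type u := UniformSpace.Completion p.Alg

namespace Compl

open UniformSpace

instance : NormedAddCommGroup p.Compl := inferInstanceAs (NormedAddCommGroup (Completion p.Alg))
instance : NormedSpace ℂ p.Compl := inferInstanceAs (NormedSpace ℂ (Completion p.Alg))
instance : CompleteSpace p.Compl := inferInstanceAs (CompleteSpace (Completion p.Alg))

/-- The canonical map of `R` to its completion. -/
def of : p.Alg →L[ℂ] p.Compl := Completion.toComplL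

theorem norm_of (x : p.Alg) : ‖of p x‖ = p.toFun x := Completion.norm_coe x

theorem isDenseInducing_of : IsDenseInducing (of p) := Completion.isDenseInducing_coe

theorem denseRange_of : DenseRange (of p) := Completion.denseRange_coe

instance : Mul p.Compl :=
  ⟨Function.curry (((isDenseInducing_of p).prodMap (isDenseInducing_of p)).extend
    fun z : p.Alg × p.Alg => of p (z.1 * z.2))⟩

theorem of_mul (x y : p.Alg) : of p (x * y) = of p x * of p y :=
  (((isDenseInducing_of p).prodMap (isDenseInducing_of p)).extend_eq
    (f := fun z : p.Alg × p.Alg => of p (z.1 * z.2)) (by fun_prop) (x, y)).symm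

/-- Multiplication of `R`, as a biadditive map to the completion. -/
def mulHom : p.Alg →+ p.Alg →+ p.Compl :=
  (AddMonoidHom.mul : p.Alg →+ p.Alg →+ p.Alg).compr₂ (of p).toLinearMap.toAddMonoidHom

theorem continuous_mulHom : Continuous fun z : p.Alg × p.Alg => mulHom p z.1 z.2 := by
  change Continuous fun z : p.Alg × p.Alg => of p (z.1 * z.2)
  fun_prop

/-- `R → p.Compl` as a homomorphism of additive groups. -/
def ofHom : p.Alg →+ p.Compl := (of p).toLinearMap.toAddMonoidHom

theorem isDenseInducing_ofHom : IsDenseInducing (ofHom p) := isDenseInducing_of p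

instance : ContinuousMul p.Compl where
  continuous_mul :=
    IsDenseInducing.extend_Z_bilin (isDenseInducing_ofHom p) (isDenseInducing_ofHom p)
      (continuous_mulHom p)

theorem uniformContinuous_of_star : UniformContinuous fun x : p.Alg => of p (star x) :=
  (of p).uniformContinuous.comp
    (starNormedAddGroupHom : NormedAddGroupHom p.Alg p.Alg).uniformContinuous

instance : Star p.Compl := ⟨Completion.extension fun x : p.Alg => of p (star x)⟩

theorem of_star (x : p.Alg) : of p (star x) = star (of p x) :=
  (Completion.extension_coe (uniformContinuous_of_star p) x).symm

instance : ContinuousStar p.Compl where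
  continuous_star := Completion.continuous_extension (f := fun x : p.Alg => of p (star x))

theorem ext_of {X : Type*} [TopologicalSpace X] [T2Space X] {f g : p.Compl → X}
    (hf : Continuous f) (hg : Continuous g) (h : ∀ y, f (of p y) = g (of p y)) (x : p.Compl) :
    f x = g x :=
  congrFun ((denseRange_of p).equalizer hf hg (funext h)) x

theorem le_of {f g : p.Compl → ℝ} (hf : Continuous f) (hg : Continuous g)
    (h : ∀ y, f (of p y) ≤ g (of p y)) (x : p.Compl) : f x ≤ g x :=
  (denseRange_of p).induction_on (p := fun x => f x ≤ g x) x (isClosed_le hf hg) h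

theorem continuous_mul_left (y : p.Compl) : Continuous fun x : p.Compl => y * x :=
  continuous_const.mul continuous_id

theorem continuous_mul_right (y : p.Compl) : Continuous fun x : p.Compl => x * y :=
  continuous_id.mul continuous_const

protected theorem mul_add (x y z : p.Compl) : x * (y + z) = x * y + x * z := by
  refine ext_of p (f := fun x => x * (y + z)) (g := fun x => x * y + x * z)
    (continuous_mul_right p _)
    ((continuous_mul_right p _).add (continuous_mul_right p _)) (fun x => ?_) x
  refine ext_of p (f := fun y => of p x * (y + z)) (g := fun y => of p x * y + of p x * z)
    ((continuous_mul_left p _).comp (continuous_id.add continuous_const))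
    ((continuous_mul_left p _).add continuous_const) (fun y => ?_) y
  refine ext_of p (f := fun z => of p x * (of p y + z))
    (g := fun z => of p x * of p y + of p x * z)
    ((continuous_mul_left p _).comp (continuous_const.add continuous_id))
    (continuous_const.add (continuous_mul_left p _)) (fun z => ?_) z
  rw [← map_add, ← of_mul, ← of_mul, ← of_mul, ← map_add, _root_.mul_add]

protected theorem star_add (x y : p.Compl) : star (x + y) = star x + star y := by
  refine ext_of p (f := fun x => star (x + y)) (g := fun x => star x + star y)
    (continuous_star.comp (continuous_id.add continuous_const))
    (continuous_star.add continuous_const) (fun x => ?_) x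
  refine ext_of p (f := fun y => star (of p x + y)) (g := fun y => star (of p x) + star y)
    (continuous_star.comp (continuous_const.add continuous_id))
    (continuous_const.add continuous_star) (fun y => ?_) y
  rw [← map_add, ← of_star, ← of_star, ← of_star, StarAddMonoid.star_add, map_add]

protected theorem star_mul (x y : p.Compl) : star (x * y) = star y * star x := by
  refine ext_of p (f := fun x => star (x * y)) (g := fun x => star y * star x)
    (continuous_star.comp (continuous_mul_right p _))
    ((continuous_mul_left p _).comp continuous_star) (fun x => ?_) x
  refine ext_of p (f := fun y => star (of p x * y)) (g := fun y => star y * star (of p x))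
    (continuous_star.comp (continuous_mul_left p _))
    ((continuous_mul_right p _).comp continuous_star) (fun y => ?_) y
  rw [← of_mul, ← of_star, ← of_star, ← of_star, ← of_mul, StarMul.star_mul]

protected theorem star_star (x : p.Compl) : star (star x) = x := by
  refine ext_of p (f := fun x => star (star x)) (g := fun x => x)
    (continuous_star.comp continuous_star) continuous_id (fun x => ?_) x
  rw [← of_star, ← of_star, _root_.star_star]

protected theorem mul_assoc (x y z : p.Compl) : x * y * z = x * (y * z) := by
  refine ext_of p (f := fun x => x * y * z) (g := fun x => x * (y * z))
    ((continuous_mul_right p _).comp (continuous_mul_right p _))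
    (continuous_mul_right p _) (fun x => ?_) x
  refine ext_of p (f := fun y => of p x * y * z) (g := fun y => of p x * (y * z))
    ((continuous_mul_right p _).comp (continuous_mul_left p _))
    ((continuous_mul_left p _).comp (continuous_mul_right p _)) (fun y => ?_) y
  refine ext_of p (f := fun z => of p x * of p y * z) (g := fun z => of p x * (of p y * z))
    (continuous_mul_left p _)
    ((continuous_mul_left p _).comp (continuous_mul_left p _)) (fun z => ?_) z
  rw [← of_mul, ← of_mul, ← of_mul, ← of_mul, _root_.mul_assoc]

protected theorem norm_mul_le (x y : p.Compl) : ‖x * y‖ ≤ ‖x‖ * ‖y‖ := by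
  refine le_of p (f := fun x => ‖x * y‖) (g := fun x => ‖x‖ * ‖y‖)
    (continuous_norm.comp (continuous_mul_right p _))
    (continuous_norm.mul continuous_const) (fun x => ?_) x
  refine le_of p (f := fun y => ‖of p x * y‖) (g := fun y => ‖of p x‖ * ‖y‖)
    (continuous_norm.comp (continuous_mul_left p _))
    (continuous_const.mul continuous_norm) (fun y => ?_) y
  rw [← of_mul, norm_of, norm_of, norm_of]
  exact p.mul_le x y

protected theorem norm_mul_self_le (x : p.Compl) : ‖x‖ * ‖x‖ ≤ ‖star x * x‖ := by
  refine le_of p (f := fun x => ‖x‖ * ‖x‖) (g := fun x => ‖star x * x‖)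
    (continuous_norm.mul continuous_norm)
    (continuous_norm.comp (continuous_star.mul continuous_id)) (fun x => ?_) x
  rw [← of_star, ← of_mul, norm_of, norm_of]
  exact p.mul_self_le x

protected theorem smul_mul [IsScalarTower ℂ R R] (c : ℂ) (x y : p.Compl) :
    (c • x) * y = c • (x * y) := by
  refine ext_of p (f := fun x => (c • x) * y) (g := fun x => c • (x * y))
    ((continuous_mul_right p _).comp (continuous_const_smul c))
    ((continuous_const_smul c).comp (continuous_mul_right p _)) (fun x => ?_) x
  refine ext_of p (f := fun y => (c • of p x) * y) (g := fun y => c • (of p x * y))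
    (continuous_mul_left p _)
    ((continuous_const_smul c).comp (continuous_mul_left p _)) (fun y => ?_) y
  rw [← map_smul, ← of_mul, ← of_mul, ← map_smul, smul_mul_assoc]

protected theorem mul_smul [SMulCommClass ℂ R R] (c : ℂ) (x y : p.Compl) :
    x * (c • y) = c • (x * y) := by
  refine ext_of p (f := fun x => x * (c • y)) (g := fun x => c • (x * y))
    (continuous_mul_right p _)
    ((continuous_const_smul c).comp (continuous_mul_right p _)) (fun x => ?_) x
  refine ext_of p (f := fun y => of p x * (c • y)) (g := fun y => c • (of p x * y))
    ((continuous_mul_left p _).comp (continuous_const_smul c))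
    ((continuous_const_smul c).comp (continuous_mul_left p _)) (fun y => ?_) y
  rw [← map_smul, ← of_mul, ← of_mul, ← map_smul, mul_smul_comm]

protected theorem star_smul [StarModule ℂ R] (c : ℂ) (x : p.Compl) :
    star (c • x) = star c • star x := by
  refine ext_of p (f := fun x => star (c • x)) (g := fun x => star c • star x)
    (continuous_star.comp (continuous_const_smul c))
    ((continuous_const_smul _).comp continuous_star) (fun x => ?_) x
  rw [← map_smul, ← of_star, ← of_star, ← map_smul, StarModule.star_smul]

protected theorem add_mul (x y z : p.Compl) : (x + y) * z = x * z + y * z := by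
  have h := Compl.mul_add p (star z) (star x) (star y)
  rw [← Compl.star_add, ← Compl.star_mul, ← Compl.star_mul, ← Compl.star_mul,
    ← Compl.star_add] at h
  simpa only [Compl.star_star] using congrArg star h

instance : NonUnitalNormedRing p.Compl where
  __ := (inferInstance : NormedAddCommGroup p.Compl)
  left_distrib := Compl.mul_add p
  right_distrib := Compl.add_mul p
  zero_mul x := by
    have h := Compl.add_mul p 0 0 x
    rwa [add_zero, left_eq_add] at h
  mul_zero x := by
    have h := Compl.mul_add p x 0 0
    rwa [add_zero, left_eq_add] at h
  mul_assoc := Compl.mul_assoc p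
  norm_mul_le := Compl.norm_mul_le p

instance : StarRing p.Compl where
  star_involutive := Compl.star_star p
  star_mul := Compl.star_mul p
  star_add := Compl.star_add p

instance [StarModule ℂ R] [IsScalarTower ℂ R R] [SMulCommClass ℂ R R] :
    NonUnitalCStarAlgebra p.Compl where
  norm_mul_self_le := Compl.norm_mul_self_le p
  norm_smul_le := norm_smul_le
  smul_assoc := Compl.smul_mul p
  smul_comm c x y := (Compl.mul_smul p c x y).symm
  star_smul := Compl.star_smul p

variable {p} {R' : Type v} [NonUnitalRing R'] [Module ℂ R'] [StarRing R'] {p' : CStarSeminorm R'}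

/-- A *-homomorphism `R → R'`, seen between the seminormed algebras. -/
def algHom (p : CStarSeminorm R) (p' : CStarSeminorm R') (f : R →⋆ₙₐ[ℂ] R') : p.Alg →⋆ₙₐ[ℂ] p'.Alg := f

/-- The function underlying the extension of a *-homomorphism to the completions. -/
def mapFun (f : R →⋆ₙₐ[ℂ] R') : p.Compl → p'.Compl :=
  Completion.map (algHom p p' f : p.Alg → p'.Alg)

theorem continuous_mapFun (f : R →⋆ₙₐ[ℂ] R') : Continuous (mapFun f : p.Compl → p'.Compl) :=
  Completion.continuous_map

theorem mapFun_of (f : R →⋆ₙₐ[ℂ] R') (hf : ∀ x, p'.toFun (f x) ≤ p.toFun x) (x : p.Alg) :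
    (mapFun f : p.Compl → p'.Compl) (of p x) = of p' (algHom p p' f x) :=
  Completion.map_coe (AddMonoidHomClass.lipschitz_of_bound (algHom p p' f) 1
    fun x => (one_mul ‖x‖).symm ▸ hf x).uniformContinuous x

/-- A *-homomorphism that is contractive for C*-seminorms extends to the completions. -/
def map (f : R →⋆ₙₐ[ℂ] R') (hf : ∀ x, p'.toFun (f x) ≤ p.toFun x) :
    p.Compl →⋆ₙₐ[ℂ] p'.Compl where
  toFun := mapFun f
  map_smul' c x := by
    refine ext_of p (f := fun x => (mapFun f (c • x) : p'.Compl))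
      (g := fun x => c • (mapFun f x : p'.Compl))
      ((continuous_mapFun f).comp (continuous_const_smul c))
      ((continuous_const_smul c).comp (continuous_mapFun f)) (fun x => ?_) x
    rw [← map_smul, mapFun_of f hf, mapFun_of f hf, map_smul, map_smul]
  map_zero' := by
    rw [← map_zero (of p), mapFun_of f hf, map_zero, map_zero]
  map_add' x y := by
    refine ext_of p (f := fun x => (mapFun f (x + y) : p'.Compl))
      (g := fun x => (mapFun f x + mapFun f y : p'.Compl))
      ((continuous_mapFun f).comp (continuous_id.add continuous_const))
      ((continuous_mapFun f).add continuous_const) (fun x => ?_) x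
    refine ext_of p (f := fun y => (mapFun f (of p x + y) : p'.Compl))
      (g := fun y => (mapFun f (of p x) + mapFun f y : p'.Compl))
      ((continuous_mapFun f).comp (continuous_const.add continuous_id))
      (continuous_const.add (continuous_mapFun f)) (fun y => ?_) y
    rw [← map_add, mapFun_of f hf, mapFun_of f hf, mapFun_of f hf, map_add, map_add]
  map_mul' x y := by
    refine ext_of p (f := fun x => (mapFun f (x * y) : p'.Compl))
      (g := fun x => (mapFun f x * mapFun f y : p'.Compl))
      ((continuous_mapFun f).comp (continuous_mul_right p _))
      ((continuous_mul_right p' _).comp (continuous_mapFun f)) (fun x => ?_) x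
    refine ext_of p (f := fun y => (mapFun f (of p x * y) : p'.Compl))
      (g := fun y => (mapFun f (of p x) * mapFun f y : p'.Compl))
      ((continuous_mapFun f).comp (continuous_mul_left p _))
      ((continuous_mul_left p' _).comp (continuous_mapFun f)) (fun y => ?_) y
    rw [← of_mul, mapFun_of f hf, mapFun_of f hf, mapFun_of f hf, map_mul, of_mul]
  map_star' x := by
    refine ext_of p (f := fun x => (mapFun f (star x) : p'.Compl))
      (g := fun x => star (mapFun f x : p'.Compl))
      ((continuous_mapFun f).comp continuous_star)
      (continuous_star.comp (continuous_mapFun f)) (fun x => ?_) x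
    rw [← of_star, mapFun_of f hf, mapFun_of f hf, map_star, of_star]

theorem map_of (f : R →⋆ₙₐ[ℂ] R') (hf : ∀ x, p'.toFun (f x) ≤ p.toFun x) (x : R) :
    map f hf (of p x) = of p' (f x) := mapFun_of f hf x

end Compl

end CStarSeminorm

/-! ### The minimal tensor product -/

section MinTensor

/-- The *-ring structure of the algebraic tensor product of two C*-algebras. -/
instance (priority := 50) {A : Type u} {B : Type v} [NonUnitalCStarAlgebra A]
    [NonUnitalCStarAlgebra B] : StarRing (A ⊗[ℂ] B) where
  star_mul x y := by
    induction x with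
    | zero => simp
    | add x x' h h' => rw [add_mul, star_add, star_add, mul_add, h, h']
    | tmul a b =>
      induction y with
      | zero => simp
      | add y y' h h' => rw [mul_add, star_add, star_add, add_mul, h, h']
      | tmul c d => simp
  star_add := star_add

/-- The spatial norm as a C*-seminorm. -/
def spatialSeminorm (A : Type u) (B : Type v) [NonUnitalCStarAlgebra A]
    [NonUnitalCStarAlgebra B] : CStarSeminorm (A ⊗[ℂ] B) where
  toFun := spatialNorm.{u, v, w}
  nonneg := spatialNorm_nonneg
  apply_zero := by
    refine le_antisymm (spatialNorm_le fun π ρ => ?_) (spatialNorm_nonneg _)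
    exact ((congrArg norm (map_zero (tensorRep π ρ))).trans ContinuousLinearMap.opNorm_zero).le
  add_le x y := spatialNorm_le fun π ρ => by
    rw [map_add]
    exact (ContinuousLinearMap.opNorm_add_le _ _).trans
      (add_le_add (le_spatialNorm π ρ x) (le_spatialNorm π ρ y))
  smul_le c x := by
    refine spatialNorm_le fun π ρ => ?_
    rw [map_smul]
    refine (ContinuousLinearMap.opNorm_smul_le _ _).trans ?_
    gcongr
    exact le_spatialNorm π ρ x
  mul_le x y := by
    refine spatialNorm_le fun π ρ => ?_
    rw [tensorRep_mul]
    refine (ContinuousLinearMap.opNorm_comp_le _ _).trans ?_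
    exact mul_le_mul (le_spatialNorm π ρ x) (le_spatialNorm π ρ y)
      (ContinuousLinearMap.opNorm_nonneg _) (spatialNorm_nonneg x)
  mul_self_le x := by
    have key : spatialNorm.{u, v, w} x ≤ √(spatialNorm.{u, v, w} (star x * x)) := by
      refine spatialNorm_le fun π ρ => ?_
      refine Real.le_sqrt_of_sq_le ?_
      rw [sq]
      exact (norm_tensorRep_mul_self_le π ρ x).trans (le_spatialNorm π ρ _)
    calc _ ≤ √(spatialNorm.{u, v, w} (star x * x)) * √(spatialNorm.{u, v, w} (star x * x)) :=
          mul_le_mul key key (spatialNorm_nonneg x) (Real.sqrt_nonneg _)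
      _ = _ := Real.mul_self_sqrt (spatialNorm_nonneg _)

/-- The minimal C*-tensor product `A ⊗ B`: the completion of the algebraic tensor product in the
spatial norm. -/
def MinTensor (A : Type u) (B : Type v) [NonUnitalCStarAlgebra A]
    [NonUnitalCStarAlgebra B] : Type (max u v) := (spatialSeminorm.{u, v, w} A B).Compl

variable {A : Type u} {B : Type v} [NonUnitalCStarAlgebra A] [NonUnitalCStarAlgebra B]

instance : NonUnitalCStarAlgebra (MinTensor.{u, v, w} A B) :=
  inferInstanceAs (NonUnitalCStarAlgebra (spatialSeminorm.{u, v, w} A B).Compl)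

/-- The canonical map of the algebraic tensor product to the minimal tensor product. -/
def ofAlgTensor : A ⊗[ℂ] B →ₗ[ℂ] MinTensor.{u, v, w} A B :=
  (CStarSeminorm.Compl.of (spatialSeminorm.{u, v, w} A B)).toLinearMap

/-- The simple tensor `a ⊗ b` in the minimal tensor product. -/
def minTmul (a : A) (b : B) : MinTensor.{u, v, w} A B := ofAlgTensor (a ⊗ₜ[ℂ] b)

theorem norm_ofAlgTensor (x : A ⊗[ℂ] B) :
    ‖(ofAlgTensor x : MinTensor.{u, v, w} A B)‖ = spatialNorm.{u, v, w} x :=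
  CStarSeminorm.Compl.norm_of (spatialSeminorm.{u, v, w} A B) x

theorem denseRange_ofAlgTensor :
    DenseRange (ofAlgTensor : A ⊗[ℂ] B → MinTensor.{u, v, w} A B) :=
  CStarSeminorm.Compl.denseRange_of (spatialSeminorm.{u, v, w} A B)

universe u' v'

variable {A' : Type u'} {B' : Type v'} [NonUnitalCStarAlgebra A'] [NonUnitalCStarAlgebra B']

/-- `φ ⊗ ψ` on the algebraic tensor products. -/
def algTensorMap (φ : A →⋆ₙₐ[ℂ] A') (ψ : B →⋆ₙₐ[ℂ] B') : A ⊗[ℂ] B →⋆ₙₐ[ℂ] A' ⊗[ℂ] B' where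
  toFun := TensorProduct.map (φ : A →ₗ[ℂ] A') (ψ : B →ₗ[ℂ] B')
  map_smul' := map_smul _
  map_zero' := map_zero _
  map_add' := map_add _
  map_mul' x y := by
    induction x with
    | zero => simp
    | add x x' h h' => rw [add_mul, map_add, map_add, h, h', add_mul]
    | tmul a b =>
      induction y with
      | zero => simp
      | add y y' h h' => rw [mul_add, map_add, map_add, h, h', mul_add]
      | tmul c d => simp
  map_star' x := by
    induction x with
    | zero => simp
    | add x x' h h' => rw [star_add, map_add, map_add, h, h', star_add]
    | tmul a b => simp [map_star]

/-- The pullback of a representation along a *-homomorphism. -/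
def HilbertRep.comap (φ : A →⋆ₙₐ[ℂ] A') (π : HilbertRep.{u', w} A') : HilbertRep.{u, w} A where
  space := π.space
  rep := π.rep.comp φ

theorem spatialNorm_map_le (φ : A →⋆ₙₐ[ℂ] A') (ψ : B →⋆ₙₐ[ℂ] B') (x : A ⊗[ℂ] B) :
    spatialNorm.{u', v', w} (algTensorMap φ ψ x) ≤ spatialNorm.{u, v, w} x := by
  refine spatialNorm_le fun π ρ => ?_
  have h : tensorRep π ρ (algTensorMap φ ψ x) = tensorRep (π.comap φ) (ρ.comap ψ) x := by
    induction x with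
    | zero => rw [map_zero, map_zero, map_zero]; rfl
    | add x y hx hy => rw [map_add, map_add, map_add, hx, hy]; rfl
    | tmul a b => rfl
  rw [h]
  exact le_spatialNorm (π.comap φ) (ρ.comap ψ) x

/-- The *-homomorphism `φ ⊗ ψ` of minimal tensor products. -/
def minMap (φ : A →⋆ₙₐ[ℂ] A') (ψ : B →⋆ₙₐ[ℂ] B') :
    MinTensor.{u, v, w} A B →⋆ₙₐ[ℂ] MinTensor.{u', v', w} A' B' :=
  CStarSeminorm.Compl.map (algTensorMap φ ψ) (spatialNorm_map_le.{u, v, w} φ ψ)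

theorem minMap_minTmul (φ : A →⋆ₙₐ[ℂ] A') (ψ : B →⋆ₙₐ[ℂ] B') (a : A) (b : B) :
    minMap φ ψ (minTmul a b : MinTensor.{u, v, w} A B) = minTmul (φ a) (ψ b) :=
  CStarSeminorm.Compl.map_of (algTensorMap φ ψ) (spatialNorm_map_le.{u, v, w} φ ψ) (a ⊗ₜ[ℂ] b)

end MinTensor

/-! ### The C*-algebraic direct sum -/

section DirectSum

variable {M : Type v} (A : M → Type u) [∀ a, CStarAlgebra (A a)]

/-- The direct sum of the C*-algebras `A a`: the families `x` with `‖x a‖ → 0`,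
that is, with `‖x a‖ < r` for all but finitely many `a`, for each `r > 0`. -/
def c0Subalgebra : NonUnitalStarSubalgebra ℂ (lp A ∞) where
  carrier := {x | Filter.Tendsto (fun a => ‖x a‖) Filter.cofinite (𝓝 0)}
  zero_mem' := by simpa using tendsto_const_nhds
  add_mem' {x y} hx hy := by
    refine squeeze_zero (fun _ => norm_nonneg _) (fun a => norm_add_le (x a) (y a)) ?_
    simpa using Filter.Tendsto.add hx hy
  mul_mem' {x y} hx hy := by
    refine squeeze_zero (fun _ => norm_nonneg _) (fun a => norm_mul_le (x a) (y a)) ?_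
    simpa using Filter.Tendsto.mul hx hy
  smul_mem' c x hx := by
    refine squeeze_zero (fun _ => norm_nonneg _) (fun a => norm_smul_le c (x a)) ?_
    simpa using Filter.Tendsto.const_mul ‖c‖ hx
  star_mem' {x} hx := by
    refine squeeze_zero (fun _ => norm_nonneg _) (fun a => (norm_star (x a)).le) hx

theorem mem_c0Subalgebra {x : lp A ∞} :
    x ∈ c0Subalgebra A ↔ Filter.Tendsto (fun a => ‖x a‖) Filter.cofinite (𝓝 0) := Iff.rfl

instance : IsClosed (c0Subalgebra A : Set (lp A ∞)) := by
  refine isClosed_of_closure_subset fun x hx => ?_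
  refine (mem_c0Subalgebra A).2 (Metric.tendsto_nhds.2 fun r hr => ?_)
  obtain ⟨y, hy, hxy⟩ := Metric.mem_closure_iff.1 hx (r / 2) (half_pos hr)
  filter_upwards [Metric.tendsto_nhds.1 ((mem_c0Subalgebra A).1 hy) (r / 2) (half_pos hr)]
    with a ha
  rw [dist_zero_right, norm_norm] at ha ⊢
  have h1 : ‖(x - y) a‖ ≤ ‖x - y‖ := lp.norm_apply_le_norm ENNReal.top_ne_zero _ _
  rw [← dist_eq_norm] at h1
  calc ‖x a‖ = ‖(x - y) a + y a‖ := by simp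
    _ ≤ ‖(x - y) a‖ + ‖y a‖ := norm_add_le _ _
    _ < r := by linarith

/-- The C*-algebra `⊕ₐ A a`. -/
def C0Sum : Type (max u v) := c0Subalgebra A

instance : NonUnitalCStarAlgebra (C0Sum A) :=
  inferInstanceAs (NonUnitalCStarAlgebra (c0Subalgebra A))

variable {A}

open Classical in
/-- The canonical embedding of `A a` in `⊕ₐ A a`. -/
def C0Sum.of (a : M) : A a →⋆ₙₐ[ℂ] C0Sum A where
  toFun x := ⟨lp.single ∞ a x, by
    refine (mem_c0Subalgebra A).2 (tendsto_const_nhds.congr' ?_)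
    filter_upwards [(Set.finite_singleton a).compl_mem_cofinite] with b hb
    rw [lp.single_apply, Pi.single_eq_of_ne hb, norm_zero]⟩
  map_smul' c x := Subtype.ext (lp.ext (Pi.single_smul a c x))
  map_zero' := Subtype.ext (lp.ext (Pi.single_zero a))
  map_add' x y := Subtype.ext (lp.ext (Pi.single_add a x y))
  map_mul' x y := Subtype.ext (lp.ext (Pi.single_mul a x y))
  map_star' x := Subtype.ext (lp.ext (Pi.single_star a x))

/-- The coordinate projection of `⊕ₐ A a` onto `A a`. -/
def C0Sum.proj (a : M) : C0Sum A →⋆ₙₐ[ℂ] A a where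
  toFun := fun x : c0Subalgebra A => (x : lp A ∞) a
  map_smul' _ _ := rfl
  map_zero' := rfl
  map_add' _ _ := rfl
  map_mul' _ _ := rfl
  map_star' _ := rfl

end DirectSum

/-! ### C*-bialgebras -/

section Bialgebra

open DoubleCentralizer
open scoped MultiplierAlgebra

variable {A : Type u} [NonUnitalCStarAlgebra A] {B : Type v} [NonUnitalCStarAlgebra B]

/-- `θ : A → M(B)` is nondegenerate: the linear span of `θ(A) B` is dense in `B`. -/
def IsNondegenerate (θ : A →⋆ₙₐ[ℂ] 𝓜(ℂ, B)) : Prop :=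
  Dense (Submodule.span ℂ {z : B | ∃ a b, z = (θ a).fst b} : Set B)

/-- `T = θ(m)`, where the nondegenerate *-homomorphism `θ : A → M(B)` is extended to `M(A)`
(the extension is the unital *-homomorphism determined by `θ(m) θ(a) b = θ(m a) b`). -/
def IsExtensionAt (θ : A →⋆ₙₐ[ℂ] 𝓜(ℂ, B)) (m : 𝓜(ℂ, A)) (T : 𝓜(ℂ, B)) : Prop :=
  IsNondegenerate θ ∧ ∀ a b, T.fst ((θ a).fst b) = (θ (m.fst a)).fst b

variable {A₁ A₂ : Type u} [NonUnitalCStarAlgebra A₁] [NonUnitalCStarAlgebra A₂]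
  {B₁ B₂ : Type u} [NonUnitalCStarAlgebra B₁] [NonUnitalCStarAlgebra B₂]

/-- `θ = φ ⊗ ψ`, for *-homomorphisms `φ : A₁ → M(B₁)` and `ψ : A₂ → M(B₂)`: the
*-homomorphism `A₁ ⊗ A₂ → M(B₁ ⊗ B₂)` determined by
`(φ ⊗ ψ)(a₁ ⊗ a₂) (b₁ ⊗ b₂) = φ(a₁) b₁ ⊗ ψ(a₂) b₂`. -/
def IsTensorHom (φ : A₁ →⋆ₙₐ[ℂ] 𝓜(ℂ, B₁)) (ψ : A₂ →⋆ₙₐ[ℂ] 𝓜(ℂ, B₂))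
    (θ : MinTensor.{u, u, w} A₁ A₂ →⋆ₙₐ[ℂ] 𝓜(ℂ, MinTensor.{u, u, w} B₁ B₂)) : Prop :=
  ∀ a₁ a₂ b₁ b₂, (θ (minTmul a₁ a₂)).fst (minTmul b₁ b₂) =
    minTmul ((φ a₁).fst b₁) ((ψ a₂).fst b₂)

/-- The graph of the canonical isomorphism `(A ⊗ B) ⊗ C ≅ A ⊗ (B ⊗ C)`: the closure of the graph
of its restriction to the algebraic tensor products. -/
def assocGraph (A B C : Type u) [NonUnitalCStarAlgebra A] [NonUnitalCStarAlgebra B]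
    [NonUnitalCStarAlgebra C] :
    Submodule ℂ (MinTensor.{u, u, w} (MinTensor.{u, u, w} A B) C ×
      MinTensor.{u, u, w} A (MinTensor.{u, u, w} B C)) :=
  (Submodule.span ℂ
    {z | ∃ a b c, z = (minTmul (minTmul a b) c, minTmul a (minTmul b c))}).topologicalClosure

/-- The multipliers `S` of `(A ⊗ B) ⊗ C` and `T` of `A ⊗ (B ⊗ C)` correspond to each other under
the canonical isomorphism of these two algebras. -/
def MultiplierAssoc {A B C : Type u} [NonUnitalCStarAlgebra A] [NonUnitalCStarAlgebra B]
    [NonUnitalCStarAlgebra C] (S : 𝓜(ℂ, MinTensor.{u, u, w} (MinTensor.{u, u, w} A B) C))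
    (T : 𝓜(ℂ, MinTensor.{u, u, w} A (MinTensor.{u, u, w} B C))) : Prop :=
  ∀ z ∈ assocGraph.{u, w} A B C, (S.fst z.1, T.fst z.2) ∈ assocGraph.{u, w} A B C

/-- `(A, Δ)` is a C*-bialgebra, where `Δ` is a *-homomorphism `A → M(A ⊗ A)`. -/
structure IsCStarBialgebra (Δ : A →⋆ₙₐ[ℂ] 𝓜(ℂ, MinTensor.{u, u, w} A A)) : Prop where
  /-- The linear span of the elements `Δ(a) (b ⊗ c)` is dense in `A ⊗ A`. -/
  dense_span : Dense (Submodule.span ℂ {z | ∃ a b c, z = (Δ a).fst (minTmul b c)} :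
    Set (MinTensor.{u, u, w} A A))
  /-- `(Δ ⊗ id) ∘ Δ = (id ⊗ Δ) ∘ Δ`, where `Δ ⊗ id` and `id ⊗ Δ` are extended to `M(A ⊗ A)`. -/
  coassoc : ∃ (ΔI : MinTensor.{u, u, w} A A →⋆ₙₐ[ℂ]
        𝓜(ℂ, MinTensor.{u, u, w} (MinTensor.{u, u, w} A A) A))
      (IΔ : MinTensor.{u, u, w} A A →⋆ₙₐ[ℂ]
        𝓜(ℂ, MinTensor.{u, u, w} A (MinTensor.{u, u, w} A A))),
    IsTensorHom Δ coeHom ΔI ∧ IsTensorHom coeHom Δ IΔ ∧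
      ∀ a, ∃ S T, IsExtensionAt ΔI (Δ a) S ∧ IsExtensionAt IΔ (Δ a) T ∧ MultiplierAssoc S T

/-- `(A, Δ)` is strictly proper: `Δ(a) ∈ A ⊗ A` for all `a`. -/
def IsStrictlyProper (Δ : A →⋆ₙₐ[ℂ] 𝓜(ℂ, MinTensor.{u, u, w} A A)) : Prop :=
  ∀ a, ∃ z : MinTensor.{u, u, w} A A, Δ a = coeHom (𝕜 := ℂ) z

/-- The *-homomorphism `ε` is a counit: `(ε ⊗ id) ∘ Δ = id = (id ⊗ ε) ∘ Δ`. Here `ε ⊗ id` and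
`id ⊗ ε` are extended to `M(A ⊗ A)`, and `A` is identified with `ℂ ⊗ A` through `a ↦ 1 ⊗ a`, and
with `A ⊗ ℂ` through `a ↦ a ⊗ 1`. -/
structure IsCounit (Δ : A →⋆ₙₐ[ℂ] 𝓜(ℂ, MinTensor.{u, u, w} A A)) (ε : A →⋆ₙₐ[ℂ] ℂ) : Prop where
  left : ∀ a, IsExtensionAt
    (coeHom.comp (minMap ε (NonUnitalStarAlgHom.id ℂ A) :
      MinTensor.{u, u, w} A A →⋆ₙₐ[ℂ] MinTensor.{0, u, w} ℂ A))
    (Δ a) (coeHom (𝕜 := ℂ) (minTmul (1 : ℂ) a))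
  right : ∀ a, IsExtensionAt
    (coeHom.comp (minMap (NonUnitalStarAlgHom.id ℂ A) ε :
      MinTensor.{u, u, w} A A →⋆ₙₐ[ℂ] MinTensor.{u, 0, w} A ℂ))
    (Δ a) (coeHom (𝕜 := ℂ) (minTmul a (1 : ℂ)))

end Bialgebra

/-! ### C*-weakly coassociative systems -/

section System

open DoubleCentralizer

variable {M : Type v} {A : M → Type u} [∀ a, CStarAlgebra (A a)]

/-- The identity of `A a`, as a map to `A b`, where `a = b`. -/
def castHom {a b : M} (h : a = b) : A a →⋆ₙₐ[ℂ] A b where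
  toFun x := h ▸ x
  map_smul' c x := by subst h; rfl
  map_zero' := by subst h; rfl
  map_add' x y := by subst h; rfl
  map_mul' x y := by subst h; rfl
  map_star' x := by subst h; rfl

variable [Monoid M]

/-- The unital C*-algebras `A a` and the *-homomorphisms `φ a b : A (a b) → A a ⊗ A b` form a
C*-weakly coassociative system over the monoid `M`, where `ε` is the counit of `A 1`. -/
structure IsCStarWCS (φ : ∀ a b : M, A (a * b) →⋆ₙₐ[ℂ] MinTensor.{u, u, w} (A a) (A b))
    (ε : A 1 →⋆ₙₐ[ℂ] ℂ) : Prop where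
  /-- `φ_{a,b}` is unital. -/
  map_one : ∀ a b, φ a b 1 = minTmul 1 1
  /-- `(φ_{a,b} ⊗ id) ∘ φ_{ab,c} = (id ⊗ φ_{b,c}) ∘ φ_{a,bc}` -/
  coassoc : ∀ (a b c : M) (x : A (a * b * c)),
    (minMap (φ a b) (NonUnitalStarAlgHom.id ℂ (A c)) (φ (a * b) c x),
      minMap (NonUnitalStarAlgHom.id ℂ (A a)) (φ b c)
        (φ a (b * c) (castHom (mul_assoc a b c) x))) ∈ assocGraph.{u, w} (A a) (A b) (A c)
  /-- `(A 1, φ_{1,1}, ε)` is a counital C*-bialgebra. -/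
  isCStarBialgebra_one :
    IsCStarBialgebra.{u, w} (coeHom.comp ((φ 1 1).comp (castHom (mul_one 1).symm)))
  isCounit_one :
    IsCounit.{u, w} (coeHom.comp ((φ 1 1).comp (castHom (mul_one 1).symm))) ε
  /-- `(ε ⊗ id) ∘ φ_{1,a} = id`, where `A a` is identified with `ℂ ⊗ A a`. -/
  counit_left : ∀ (a : M) (x : A a),
    (minMap ε (NonUnitalStarAlgHom.id ℂ (A a)) (φ 1 a (castHom (one_mul a).symm x)) :
      MinTensor.{0, u, w} ℂ (A a)) = minTmul 1 x
  /-- `(id ⊗ ε) ∘ φ_{a,1} = id`, where `A a` is identified with `A a ⊗ ℂ`. -/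
  counit_right : ∀ (a : M) (x : A a),
    (minMap (NonUnitalStarAlgHom.id ℂ (A a)) ε (φ a 1 (castHom (mul_one a).symm x)) :
      MinTensor.{u, 0, w} (A a) ℂ) = minTmul x 1

/-- `Δ = ⊕ₐ Δ⁽ᵃ⁾`, where `Δ⁽ᵃ⁾(x)` is the sum of the elements `φ_{b,c}(x)` of
`A b ⊗ A c ⊆ (⊕ₐ A a) ⊗ (⊕ₐ A a)` over the pairs `(b, c)` with `b c = a`
(of which there are finitely many), embedded by means of the canonical maps `A b → ⊕ₐ A a`. -/
def IsDirectSumComul (φ : ∀ a b : M, A (a * b) →⋆ₙₐ[ℂ] MinTensor.{u, u, w} (A a) (A b))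
    (Δ : C0Sum A →⋆ₙₐ[ℂ] MinTensor.{max u v, max u v, w} (C0Sum A) (C0Sum A)) : Prop :=
  ∀ (a : M) (x : A a), Δ (C0Sum.of a x) = ∑ᶠ p : {p : M × M // p.1 * p.2 = a},
    minMap (C0Sum.of p.1.1) (C0Sum.of p.1.2) (φ p.1.1 p.1.2 (castHom p.2.symm x))

end System

end

/-! Each pair `(b, c)` gives a *-homomorphism `comulTerm φ (b, c)` of `⊕ₐ A a`: project to the
coordinate `b * c`, apply `φ b c`, and embed `A b ⊗ A c`. Different pairs have ranges with product
zero. A finite sum of orthogonal *-homomorphisms is again one, and its norm is controlled by the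
largest component. Since each element has finitely many factorizations and the coordinates of `x`
tend to zero, the components of `x` tend to zero along the pairs too. So the sum over all pairs
converges in norm (`summable_orthogonal`, `summable_comulTerm`) and is a *-homomorphism `comul` into
the tensor product itself. It is determined by its values on the `A a`, whose span is dense.

As `comul` does not leave `A_* ⊗ A_*`, extensions to multiplier algebras reduce to multiplication by
elements (`isExtensionAt_coeHom`), once nondegeneracy is known. Nondegeneracy comes from unitality
of the `φ b c`: `comul` of the unit of `A (b * c)` acts as the identity on `A b ⊗ A c`
(`comul_one_mul`).

On `A d` both sides of coassociativity are finite sums over factorizations `d = a b c`. They agree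
term by term by the axiom of the system, after regrouping (`sum_factorizations_assoc`). The
associator enters only through its graph, a closed subspace that is stable under multiplication and
under tensor products of *-homomorphisms. For the counit, `ε ⊗ id` kills all components of `comul`
on `A d` except that of `(1, d)`, where the counit axiom applies; `id ⊗ ε` is symmetric. -/

noncomputable section

/-! ### Sums of orthogonal *-homomorphisms -/

section OrthogonalSum

variable {ι : Type*} {B : ι → Type*} [∀ i, NonUnitalCStarAlgebra (B i)]
  {C : Type*} [NonUnitalCStarAlgebra C]

/-- The sum of pairwise orthogonal *-homomorphisms on a finite product of C*-algebras. -/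
def orthogonalSumHom [Fintype ι] (j : ∀ i, B i →⋆ₙₐ[ℂ] C)
    (hj : ∀ i k, i ≠ k → ∀ x y, j i x * j k y = 0) : (∀ i, B i) →⋆ₙₐ[ℂ] C where
  toFun y := ∑ i, j i (y i)
  map_smul' c y := by simp [Finset.smul_sum]
  map_zero' := by simp
  map_add' x y := by simp [Finset.sum_add_distrib]
  map_mul' x y := by
    simp only [Pi.mul_apply, map_mul, Finset.sum_mul_sum]
    refine Finset.sum_congr rfl fun i _ => ?_
    rw [Finset.sum_eq_single i (fun k _ hk => hj i k hk.symm _ _) (by simp)]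
  map_star' x := by simp [map_star, star_sum]

/-- The sum is the value of a *-homomorphism on a finite product, whose norm is the supremum norm,
and *-homomorphisms of C*-algebras are contractive. -/
theorem norm_sum_orthogonal_le (j : ∀ i, B i →⋆ₙₐ[ℂ] C)
    (hj : ∀ i k, i ≠ k → ∀ x y, j i x * j k y = 0) (s : Finset ι) (y : ∀ i, B i) {r : ℝ}
    (hr : 0 ≤ r) (hy : ∀ i ∈ s, ‖y i‖ ≤ r) : ‖∑ i ∈ s, j i (y i)‖ ≤ r := by
  have h := NonUnitalStarAlgHom.norm_apply_le
    (orthogonalSumHom (fun i : s => j i) fun i k hik => hj i k fun h => hik (Subtype.ext h))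
    fun i : s => y i
  rw [← Finset.sum_coe_sort s fun i => j i (y i)]
  exact h.trans ((pi_norm_le_iff_of_nonneg hr).2 fun i => hy i i.2)

/-- Cauchy criterion: away from the finitely many indices with `‖y i‖ ≥ r / 2`, orthogonality bounds
every finite sum by `r / 2`, however many terms it has. -/
theorem summable_orthogonal (j : ∀ i, B i →⋆ₙₐ[ℂ] C)
    (hj : ∀ i k, i ≠ k → ∀ x y, j i x * j k y = 0) (y : ∀ i, B i)
    (hy : Filter.Tendsto (fun i => ‖y i‖) Filter.cofinite (𝓝 0)) :
    Summable fun i => j i (y i) := by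
  classical
  refine summable_iff_vanishing_norm.2 fun r hr => ?_
  have h := (Metric.tendsto_nhds.1 hy (r / 2) (half_pos hr))
  refine ⟨(Filter.eventually_cofinite.1 h).toFinset, fun t ht => ?_⟩
  refine (norm_sum_orthogonal_le j hj t y (half_pos hr).le fun i hi => ?_).trans_lt (half_lt_self hr)
  by_contra hlt
  refine Finset.disjoint_left.1 ht hi ((Set.Finite.mem_toFinset _).2 fun h' => hlt ?_)
  simpa using h'.le

variable {D : Type*} [NonUnitalCStarAlgebra D]

/-- The sum of a family of pairwise orthogonal *-homomorphisms that is summable at each point. -/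
def tsumHom (t : ι → D →⋆ₙₐ[ℂ] C) (ht : ∀ i k, i ≠ k → ∀ x y, t i x * t k y = 0)
    (hs : ∀ x, Summable fun i => t i x) : D →⋆ₙₐ[ℂ] C where
  toFun x := ∑' i, t i x
  map_smul' c x := by simp [(hs x).tsum_const_smul]
  map_zero' := by simp
  map_add' x y := by simp [(hs x).tsum_add (hs y)]
  map_mul' x y := by
    have h : HasSum (fun i => t i (x * y)) ((∑' i, t i x) * ∑' i, t i y) := by
      -- Multiply the partial sums over the same finite set `s`: by orthogonality only the diagonal
      -- terms remain.
      refine (Filter.Tendsto.mul (hs x).hasSum (hs y).hasSum).congr fun s => ?_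
      rw [Finset.sum_mul_sum]
      refine Finset.sum_congr rfl fun i hi => ?_
      rw [Finset.sum_eq_single i (fun k _ hk => ht i k hk.symm _ _) fun h => absurd hi h]
      exact (map_mul (t i) x y).symm
    exact h.tsum_eq
  map_star' x := by simp [map_star, tsum_star]

end OrthogonalSum

/-! ### Density arguments through closed subspaces -/

section DenseSpan

variable {E : Type*} {F : Type*} [NormedAddCommGroup E] [NormedSpace ℂ E]
  [NormedAddCommGroup F] [NormedSpace ℂ F]

theorem mem_of_dense_span {S : Set E} (hS : Dense (Submodule.span ℂ S : Set E))
    (K : Submodule ℂ E) (hK : IsClosed (K : Set E)) (h : S ⊆ K) (x : E) : x ∈ K :=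
  closure_minimal (Submodule.span_le.2 h) hK (hS x)

theorem dense_span_iff {S : Set E} : Dense (Submodule.span ℂ S : Set E) ↔
    ∀ K : Submodule ℂ E, IsClosed (K : Set E) → S ⊆ K → K = ⊤ := by
  refine ⟨fun hS K hK h => eq_top_iff.2 fun x _ => mem_of_dense_span hS K hK h x, fun h => ?_⟩
  rw [Submodule.dense_iff_topologicalClosure_eq_top]
  exact h _ (Submodule.isClosed_topologicalClosure _)
    (Submodule.subset_span.trans (Submodule.le_topologicalClosure _))

theorem eq_of_dense_span {S : Set E} (hS : Dense (Submodule.span ℂ S : Set E))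
    {f g : E →L[ℂ] F} (h : ∀ x ∈ S, f x = g x) : f = g :=
  ContinuousLinearMap.ext_on hS h

/-- A *-homomorphism of C*-algebras, as a continuous linear map. -/
def homCLM {A : Type*} {B : Type*} [NonUnitalCStarAlgebra A] [NonUnitalCStarAlgebra B]
    (f : A →⋆ₙₐ[ℂ] B) : A →L[ℂ] B :=
  LinearMap.mkContinuous (f : A →ₗ[ℂ] B) 1 fun x => by
    rw [one_mul]; exact NonUnitalStarAlgHom.norm_apply_le f x

theorem homCLM_apply {A : Type*} {B : Type*} [NonUnitalCStarAlgebra A] [NonUnitalCStarAlgebra B]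
    (f : A →⋆ₙₐ[ℂ] B) (x : A) : homCLM f x = f x := rfl

end DenseSpan

/-! ### Calculus of the minimal tensor product -/

section MinTensorBasic

variable {A : Type u} {B : Type v} [NonUnitalCStarAlgebra A] [NonUnitalCStarAlgebra B]

theorem minTmul_mul_minTmul (a c : A) (b d : B) :
    (minTmul a b * minTmul c d : MinTensor.{u, v, w} A B) = minTmul (a * c) (b * d) :=
  ((congrArg ofAlgTensor (Algebra.TensorProduct.tmul_mul_tmul a c b d).symm).trans
    (CStarSeminorm.Compl.of_mul (spatialSeminorm.{u, v, w} A B) (a ⊗ₜ[ℂ] b) (c ⊗ₜ[ℂ] d))).symm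


theorem norm_minTmul_le (a : A) (b : B) :
    ‖(minTmul a b : MinTensor.{u, v, w} A B)‖ ≤ ‖a‖ * ‖b‖ := by
  rw [minTmul, norm_ofAlgTensor]
  refine spatialNorm_le fun π ρ => (norm_mapL_le _ _).trans ?_
  gcongr
  · exact NonUnitalStarAlgHom.norm_apply_le _ _
  · exact NonUnitalStarAlgHom.norm_apply_le _ _

/-- `minTmul` as a continuous bilinear map. -/
def minTmulL : A →L[ℂ] B →L[ℂ] MinTensor.{u, v, w} A B :=
  LinearMap.mkContinuous₂ ((TensorProduct.mk ℂ A B).compr₂ ofAlgTensor) 1 fun a b => by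
    rw [one_mul]; exact norm_minTmul_le a b

theorem minTmulL_apply (a : A) (b : B) :
    (minTmulL a b : MinTensor.{u, v, w} A B) = minTmul a b := rfl

theorem minTmulL_flip_apply (a : A) (b : B) :
    (minTmulL.flip b a : MinTensor.{u, v, w} A B) = minTmul a b := rfl

/-- One variable at a time: with the other factor fixed, `minTmul` is continuous and linear, so the
closed subspace `K` pulls back to a closed subspace. First `b` is freed from `T`, then `a` from `S`.
-/
theorem minTensor_eq_top {S : Set A} {T : Set B} (hS : Dense (Submodule.span ℂ S : Set A))
    (hT : Dense (Submodule.span ℂ T : Set B)) (K : Submodule ℂ (MinTensor.{u, v, w} A B))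
    (hK : IsClosed (K : Set (MinTensor.{u, v, w} A B)))
    (h : ∀ a ∈ S, ∀ b ∈ T, minTmul a b ∈ K) : K = ⊤ := by
  have h1 : ∀ a ∈ S, ∀ b, minTmul a b ∈ K := fun a ha b =>
    mem_of_dense_span hT (K.comap (minTmulL a).toLinearMap)
      (hK.preimage (minTmulL a).continuous) (fun b hb => h a ha b hb) b
  have h2 : ∀ a b, minTmul a b ∈ K := fun a b => by
    set f : A →L[ℂ] MinTensor.{u, v, w} A B := minTmulL.flip b with hf
    have hf' : ∀ a, f a = minTmul a b := fun a => minTmulL_flip_apply a b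
    clear_value f
    rw [← hf']
    exact mem_of_dense_span hS (K.comap f.toLinearMap) (hK.preimage f.continuous)
      (fun a ha => show f a ∈ K from (hf' a).symm ▸ h1 a ha b) a
  have h3 : ∀ x : A ⊗[ℂ] B, ofAlgTensor x ∈ K := fun x => by
    induction x with
    | zero => rw [map_zero]; exact K.zero_mem
    | add x y hx hy => rw [map_add]; exact K.add_mem hx hy
    | tmul a b => exact h2 a b
  exact eq_top_iff.2 fun z _ =>
    denseRange_ofAlgTensor.induction_on (p := fun z => z ∈ K) z hK h3

theorem dense_span_minTmul {S : Set A} {T : Set B} (hS : Dense (Submodule.span ℂ S : Set A))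
    (hT : Dense (Submodule.span ℂ T : Set B)) :
    Dense (Submodule.span ℂ {z : MinTensor.{u, v, w} A B | ∃ a ∈ S, ∃ b ∈ T, z = minTmul a b} :
      Set (MinTensor.{u, v, w} A B)) := 
  dense_span_iff.2 fun K hK h => minTensor_eq_top hS hT K hK fun a ha b hb => h ⟨a, ha, b, hb, rfl⟩

theorem dense_span_univ {E : Type*} [NormedAddCommGroup E] [NormedSpace ℂ E] :
    Dense (Submodule.span ℂ (Set.univ : Set E) : Set E) := by
  rw [Submodule.span_univ]
  exact dense_univ

theorem minTmul_sum_left {ι : Type*} (s : Finset ι) (f : ι → A) (b : B) :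
    (minTmul (∑ i ∈ s, f i) b : MinTensor.{u, v, w} A B) = ∑ i ∈ s, minTmul (f i) b := by
  simp only [← minTmulL_flip_apply, map_sum]

theorem minTmul_sum_right {ι : Type*} (s : Finset ι) (a : A) (f : ι → B) :
    (minTmul a (∑ i ∈ s, f i) : MinTensor.{u, v, w} A B) = ∑ i ∈ s, minTmul a (f i) := by
  simp only [← minTmulL_apply, map_sum]

theorem minTmul_zero_left (b : B) : (minTmul 0 b : MinTensor.{u, v, w} A B) = 0 := by
  rw [← minTmulL_flip_apply, map_zero]

theorem minTmul_zero_right (a : A) : (minTmul a 0 : MinTensor.{u, v, w} A B) = 0 := by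
  rw [← minTmulL_apply, map_zero]

theorem eq_of_minTmul {F : Type*} [NormedAddCommGroup F] [NormedSpace ℂ F]
    {f g : MinTensor.{u, v, w} A B →L[ℂ] F} (h : ∀ a b, f (minTmul a b) = g (minTmul a b)) :
    f = g := by
  have hd := dense_span_minTmul.{u, v, w} (A := A) (B := B) dense_span_univ dense_span_univ
  refine eq_of_dense_span hd fun z hz => ?_
  obtain ⟨a, -, b, -, rfl⟩ := hz
  exact h a b

universe u' v' u'' v''

variable {A' : Type u'} {B' : Type v'} [NonUnitalCStarAlgebra A'] [NonUnitalCStarAlgebra B']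
  {A'' : Type u''} {B'' : Type v''} [NonUnitalCStarAlgebra A''] [NonUnitalCStarAlgebra B'']

theorem minMap_minMap (φ : A →⋆ₙₐ[ℂ] A') (ψ : B →⋆ₙₐ[ℂ] B') (φ' : A' →⋆ₙₐ[ℂ] A'')
    (ψ' : B' →⋆ₙₐ[ℂ] B'') (z : MinTensor.{u, v, w} A B) :
    (minMap φ' ψ' (minMap φ ψ z : MinTensor.{u', v', w} A' B') : MinTensor.{u'', v'', w} A'' B'') =
      minMap (φ'.comp φ) (ψ'.comp ψ) z := by
  have key : (homCLM (minMap φ' ψ' : MinTensor.{u', v', w} A' B' →⋆ₙₐ[ℂ] MinTensor A'' B'')).comp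
      (homCLM (minMap φ ψ)) = homCLM (minMap (φ'.comp φ) (ψ'.comp ψ)) :=
    eq_of_minTmul fun a b => by
      simp only [ContinuousLinearMap.comp_apply, homCLM_apply, minMap_minTmul]
      rfl
  exact DFunLike.congr_fun key z

/-- A sum of *-homomorphisms need not be multiplicative, so the sum is not formed as a
*-homomorphism: `φ` is given, and agrees with it pointwise. -/
theorem minMap_eq_sum_left {ι : Type*} (s : Finset ι) (φ : A →⋆ₙₐ[ℂ] A') (f : ι → A →⋆ₙₐ[ℂ] A')
    (ψ : B →⋆ₙₐ[ℂ] B') (h : ∀ a, φ a = ∑ i ∈ s, f i a) (z : MinTensor.{u, v, w} A B) :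
    (minMap φ ψ z : MinTensor.{u', v', w} A' B') = ∑ i ∈ s, minMap (f i) ψ z := by
  have key : homCLM (minMap φ ψ : MinTensor.{u, v, w} A B →⋆ₙₐ[ℂ] MinTensor.{u', v', w} A' B') =
      ∑ i ∈ s, homCLM (minMap (f i) ψ) :=
    eq_of_minTmul fun a b => by
      simp only [sum_apply, homCLM_apply, minMap_minTmul, h,
        minTmul_sum_left]
  simpa only [sum_apply, homCLM_apply] using DFunLike.congr_fun key z

theorem minMap_eq_sum_right {ι : Type*} (s : Finset ι) (φ : A →⋆ₙₐ[ℂ] A') (ψ : B →⋆ₙₐ[ℂ] B')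
    (f : ι → B →⋆ₙₐ[ℂ] B') (h : ∀ b, ψ b = ∑ i ∈ s, f i b) (z : MinTensor.{u, v, w} A B) :
    (minMap φ ψ z : MinTensor.{u', v', w} A' B') = ∑ i ∈ s, minMap φ (f i) z := by
  have key : homCLM (minMap φ ψ : MinTensor.{u, v, w} A B →⋆ₙₐ[ℂ] MinTensor.{u', v', w} A' B') =
      ∑ i ∈ s, homCLM (minMap φ (f i)) :=
    eq_of_minTmul fun a b => by
      simp only [sum_apply, homCLM_apply, minMap_minTmul, h,
        minTmul_sum_right]
  simpa only [sum_apply, homCLM_apply] using DFunLike.congr_fun key z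

theorem minMap_zero_left (ψ : B →⋆ₙₐ[ℂ] B') (z : MinTensor.{u, v, w} A B) :
    (minMap (0 : A →⋆ₙₐ[ℂ] A') ψ z : MinTensor.{u', v', w} A' B') = 0 := by
  rw [minMap_eq_sum_left (∅ : Finset Unit) (0 : A →⋆ₙₐ[ℂ] A') (fun _ => 0) ψ (fun _ => rfl) z,
    Finset.sum_empty]

theorem minMap_zero_right (φ : A →⋆ₙₐ[ℂ] A') (z : MinTensor.{u, v, w} A B) :
    (minMap φ (0 : B →⋆ₙₐ[ℂ] B') z : MinTensor.{u', v', w} A' B') = 0 := by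
  rw [minMap_eq_sum_right (∅ : Finset Unit) φ (0 : B →⋆ₙₐ[ℂ] B') (fun _ => 0) (fun _ => rfl) z,
    Finset.sum_empty]

/-- Orthogonality in one tensor factor is enough, because products of simple tensors are computed
factorwise. Continuity of multiplication in each variable extends this from simple tensors. -/
theorem minMap_mul_minMap_eq_zero {φ : A →⋆ₙₐ[ℂ] A''} {φ' : A' →⋆ₙₐ[ℂ] A''}
    {ψ : B →⋆ₙₐ[ℂ] B''} {ψ' : B' →⋆ₙₐ[ℂ] B''}
    (h : (∀ a a', φ a * φ' a' = 0) ∨ ∀ b b', ψ b * ψ' b' = 0)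
    (y : MinTensor.{u, v, w} A B) (z : MinTensor.{u', v', w} A' B') :
    (minMap φ ψ y * minMap φ' ψ' z : MinTensor.{u'', v'', w} A'' B'') = 0 := by
  have h0 : ∀ a b a' b',
      (minTmul (φ a * φ' a') (ψ b * ψ' b') : MinTensor.{u'', v'', w} A'' B'') = 0 := by
    intro a b a' b'
    rcases h with h | h
    · rw [h, minTmul_zero_left]
    · rw [h, minTmul_zero_right]
  have h1 : ∀ a b, (ContinuousLinearMap.mul ℂ _ (minMap φ ψ (minTmul a b))).comp
      (homCLM (minMap φ' ψ' : MinTensor.{u', v', w} A' B' →⋆ₙₐ[ℂ] MinTensor.{u'', v'', w} A'' B''))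
        = 0 := fun a b => eq_of_minTmul fun a' b' => by
    simp only [ContinuousLinearMap.comp_apply, ContinuousLinearMap.mul_apply', homCLM_apply,
      minMap_minTmul, minTmul_mul_minTmul, h0, zero_apply]
  have h2 : ((ContinuousLinearMap.mul ℂ _).flip (minMap φ' ψ' z)).comp
      (homCLM (minMap φ ψ : MinTensor.{u, v, w} A B →⋆ₙₐ[ℂ] MinTensor.{u'', v'', w} A'' B''))
        = 0 := eq_of_minTmul fun a b => by
    exact DFunLike.congr_fun (h1 a b) z
  exact DFunLike.congr_fun h2 y

end MinTensorBasic

/-! ### Coordinates in the direct sum -/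

namespace C0Sum

variable {M : Type v} {A : M → Type u} [∀ a, CStarAlgebra (A a)]

theorem proj_of_self (a : M) (x : A a) : proj a (of a x) = x := by
  classical exact lp.single_apply_self ∞ a x

theorem proj_of_ne {a b : M} (h : b ≠ a) (x : A a) : proj b (of a x) = 0 := by
  classical exact lp.single_apply_ne ∞ a x h

theorem ext_proj {x y : C0Sum A} (h : ∀ a, proj a x = proj a y) : x = y :=
  Subtype.ext (lp.ext (funext h))

theorem of_mul_of_ne {a b : M} (h : a ≠ b) (x : A a) (y : A b) : of a x * of b y = 0 := by
  refine ext_proj fun c => ?_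
  rw [map_mul, map_zero]
  rcases eq_or_ne c a with rfl | hc
  · rw [proj_of_ne h, mul_zero]
  · rw [proj_of_ne hc, zero_mul]

theorem tendsto_norm_proj (x : C0Sum A) :
    Filter.Tendsto (fun a => ‖proj a x‖) Filter.cofinite (𝓝 0) :=
  x.2

/-- The embedded coordinates are orthogonal and tend to zero, hence are summable; the limit is
identified by applying the continuous coordinate projections. -/
theorem hasSum_of_proj (x : C0Sum A) : HasSum (fun a => of a (proj a x)) x := by
  have h : Summable fun a => of a (proj a x) :=
    summable_orthogonal (C := C0Sum A) (fun a => of a) (fun i k hik x y => of_mul_of_ne hik x y)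
      (fun a => proj a x) (tendsto_norm_proj x)
  have key : ∑' a, of a (proj a x) = x := ext_proj fun b => by
    have h1 := (homCLM (proj b)).hasSum h.hasSum
    refine h1.unique ?_
    have h2 := hasSum_single (f := fun a => homCLM (proj b) (of a (proj a x))) b
      fun a ha => proj_of_ne ha.symm _
    simpa only [homCLM_apply, proj_of_self] using h2
  have h3 := h.hasSum
  rwa [key] at h3

theorem dense_span_of :
    Dense (Submodule.span ℂ {z : C0Sum A | ∃ a x, z = of a x} : Set (C0Sum A)) := by
  refine dense_span_iff.2 fun K hK h => eq_top_iff.2 fun x _ => ?_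
  exact hK.mem_of_tendsto (hasSum_of_proj x)
    (Filter.Eventually.of_forall fun s => K.sum_mem fun a _ => h ⟨a, _, rfl⟩)

theorem proj_of_comp_self (a : M) :
    (proj a).comp (of a) = NonUnitalStarAlgHom.id ℂ (A a) :=
  NonUnitalStarAlgHom.ext fun x => proj_of_self a x

/-- Lets transports along equalities in `M`, such as associativity, be absorbed into the choice of
coordinate. -/
theorem castHom_proj {a b : M} (h : a = b) (x : C0Sum A) : castHom h (proj a x) = proj b x := by
  subst h; rfl

/-- Different pairs differ in some coordinate, and the embeddings are orthogonal in that tensor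
factor. -/
theorem minMap_of_mul_minMap_of {p q : M × M} (h : p ≠ q)
    (y : MinTensor.{u, u, w} (A p.1) (A p.2)) (z : MinTensor.{u, u, w} (A q.1) (A q.2)) :
    (minMap (of p.1) (of p.2) y * minMap (of q.1) (of q.2) z :
      MinTensor.{max u v, max u v, w} (C0Sum A) (C0Sum A)) = 0 := by
  refine minMap_mul_minMap_eq_zero ?_ y z
  by_cases h1 : p.1 = q.1
  · exact Or.inr (of_mul_of_ne fun h2 => h (Prod.ext h1 h2))
  · exact Or.inl (of_mul_of_ne h1)

end C0Sum

/-! ### Construction and uniqueness of the comultiplication -/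

section Comul

variable {M : Type v} {A : M → Type u} [∀ a, CStarAlgebra (A a)] [Monoid M]
  (φ : ∀ a b : M, A (a * b) →⋆ₙₐ[ℂ] MinTensor.{u, u, w} (A a) (A b))

/-- The component `φ_{b,c}` of the comultiplication of `⊕ₐ A a`. -/
def comulTerm (p : M × M) :
    C0Sum A →⋆ₙₐ[ℂ] MinTensor.{max u v, max u v, w} (C0Sum A) (C0Sum A) :=
  (minMap (C0Sum.of p.1) (C0Sum.of p.2)).comp ((φ p.1 p.2).comp (C0Sum.proj (p.1 * p.2)))

theorem comulTerm_apply (p : M × M) (x : C0Sum A) : comulTerm φ p x =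
    minMap (C0Sum.of p.1) (C0Sum.of p.2) (φ p.1 p.2 (C0Sum.proj (p.1 * p.2) x)) := rfl

theorem comulTerm_of_mul (b c : M) (x : A (b * c)) :
    comulTerm φ (b, c) (C0Sum.of (b * c) x) =
      minMap (C0Sum.of b) (C0Sum.of c) (φ b c x) := by
  rw [comulTerm_apply, C0Sum.proj_of_self]

theorem comulTerm_of_ne {p : M × M} {a : M} (h : p.1 * p.2 ≠ a) (x : A a) :
    comulTerm φ p (C0Sum.of a x) = 0 := by
  rw [comulTerm_apply, C0Sum.proj_of_ne h, map_zero, map_zero]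

theorem summable_comulTerm (hfin : ∀ a : M, {p : M × M | p.1 * p.2 = a}.Finite) (x : C0Sum A) : Summable fun p => comulTerm φ p x := by
  refine summable_orthogonal
    (fun p : M × M => (minMap (C0Sum.of p.1) (C0Sum.of p.2) : MinTensor.{u, u, w} (A p.1) (A p.2)
      →⋆ₙₐ[ℂ] MinTensor.{max u v, max u v, w} (C0Sum A) (C0Sum A)))
    (fun p q h => C0Sum.minMap_of_mul_minMap_of h)
    (fun p => φ p.1 p.2 (C0Sum.proj (p.1 * p.2) x)) ?_
  -- Finiteness of the factorization sets says exactly that multiplication has finite fibres, so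
  -- decay of the coordinates over `M` becomes decay over `M × M`.
  have h : Filter.Tendsto (fun p : M × M => p.1 * p.2) Filter.cofinite Filter.cofinite :=
    Filter.Tendsto.cofinite_of_finite_preimage_singleton fun a => hfin a
  exact squeeze_zero (fun _ => norm_nonneg _)
    (fun p => NonUnitalStarAlgHom.norm_apply_le (φ p.1 p.2) _) ((C0Sum.tendsto_norm_proj x).comp h)

variable (hfin : ∀ a : M, {p : M × M | p.1 * p.2 = a}.Finite)

/-- The comultiplication of `⊕ₐ A a`. -/
def comul : C0Sum A →⋆ₙₐ[ℂ] MinTensor.{max u v, max u v, w} (C0Sum A) (C0Sum A) :=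
  tsumHom (comulTerm φ) (fun _ _ h _ _ => C0Sum.minMap_of_mul_minMap_of h _ _)
    (summable_comulTerm φ hfin)

theorem hasSum_comul (x : C0Sum A) : HasSum (fun p => comulTerm φ p x) (comul φ hfin x) :=
  (summable_comulTerm φ hfin x).hasSum

theorem comul_of (a : M) (x : A a) : comul φ hfin (C0Sum.of a x) =
    ∑ p ∈ (hfin a).toFinset, comulTerm φ p (C0Sum.of a x) := by
  refine (hasSum_comul φ hfin _).unique (hasSum_sum_of_ne_finset_zero fun p hp => ?_)
  exact comulTerm_of_ne φ (fun h => hp ((hfin a).mem_toFinset.2 h)) x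

theorem comul_of_eq_finsum (a : M) (x : A a) :
    comul φ hfin (C0Sum.of a x) = ∑ᶠ p : {p : M × M // p.1 * p.2 = a},
      minMap (C0Sum.of p.1.1) (C0Sum.of p.1.2) (φ p.1.1 p.1.2 (castHom p.2.symm x)) := by
  rw [comul_of, ← finsum_mem_eq_finite_toFinset_sum _ (hfin a), ← finsum_set_coe_eq_finsum_mem]
  refine finsum_congr ?_
  -- Substituting `a = b * c` turns `castHom` into the identity.
  rintro ⟨⟨b, c⟩, rfl⟩
  exact comulTerm_of_mul φ b c x

theorem isDirectSumComul_comul : IsDirectSumComul φ (comul φ hfin) :=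
  comul_of_eq_finsum φ hfin

/-- *-homomorphisms are continuous, and the embedded `A a` span a dense subspace. -/
theorem IsDirectSumComul.eq {φ : ∀ a b : M, A (a * b) →⋆ₙₐ[ℂ] MinTensor.{u, u, w} (A a) (A b)}
    {Δ Δ' : C0Sum A →⋆ₙₐ[ℂ] MinTensor.{max u v, max u v, w} (C0Sum A) (C0Sum A)}
    (h : IsDirectSumComul φ Δ) (h' : IsDirectSumComul φ Δ') : Δ = Δ' := by
  have key : homCLM Δ = homCLM Δ' := eq_of_dense_span C0Sum.dense_span_of fun z hz => by
    obtain ⟨a, x, rfl⟩ := hz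
    exact (h a x).trans (h' a x).symm
  exact NonUnitalStarAlgHom.ext fun x => DFunLike.congr_fun key x

end Comul

/-! ### The graph of the associativity isomorphism -/

section AssocGraph

variable {A B C : Type u} [NonUnitalCStarAlgebra A] [NonUnitalCStarAlgebra B]
  [NonUnitalCStarAlgebra C]

theorem isClosed_assocGraph : IsClosed (assocGraph.{u, w} A B C : Set
    (MinTensor.{u, u, w} (MinTensor.{u, u, w} A B) C ×
      MinTensor.{u, u, w} A (MinTensor.{u, u, w} B C))) :=
  Submodule.isClosed_topologicalClosure _

theorem minTmul_mem_assocGraph (a : A) (b : B) (c : C) :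
    (minTmul (minTmul a b) c, minTmul a (minTmul b c)) ∈ assocGraph.{u, w} A B C :=
  Submodule.le_topologicalClosure _ (Submodule.subset_span ⟨a, b, c, rfl⟩)

theorem assocGraph_le {K : Submodule ℂ (MinTensor.{u, u, w} (MinTensor.{u, u, w} A B) C ×
      MinTensor.{u, u, w} A (MinTensor.{u, u, w} B C))} (hK : IsClosed (K : Set
    (MinTensor.{u, u, w} (MinTensor.{u, u, w} A B) C ×
      MinTensor.{u, u, w} A (MinTensor.{u, u, w} B C))))
    (h : ∀ a b c, (minTmul (minTmul a b) c, minTmul a (minTmul b c)) ∈ K) :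
    assocGraph.{u, w} A B C ≤ K := by
  refine Submodule.topologicalClosure_minimal _ (Submodule.span_le.2 ?_) hK
  rintro z ⟨a, b, c, rfl⟩
  exact h a b c

/-- Preimages of `assocGraph` under continuous linear maps. -/
theorem mem_assocGraph_of_map {A' B' C' : Type v} [NonUnitalCStarAlgebra A']
    [NonUnitalCStarAlgebra B'] [NonUnitalCStarAlgebra C']
    (F : MinTensor.{u, u, w} (MinTensor.{u, u, w} A B) C →L[ℂ]
      MinTensor.{v, v, w} (MinTensor.{v, v, w} A' B') C')
    (G : MinTensor.{u, u, w} A (MinTensor.{u, u, w} B C) →L[ℂ]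
      MinTensor.{v, v, w} A' (MinTensor.{v, v, w} B' C'))
    (h : ∀ a b c, (F (minTmul (minTmul a b) c), G (minTmul a (minTmul b c))) ∈
      assocGraph.{v, w} A' B' C')
    {z} (hz : z ∈ assocGraph.{u, w} A B C) : (F z.1, G z.2) ∈ assocGraph.{v, w} A' B' C' := by
  have hc : IsClosed ((assocGraph.{v, w} A' B' C').comap (F.prodMap G).toLinearMap : Set
      (MinTensor.{u, u, w} (MinTensor.{u, u, w} A B) C ×
        MinTensor.{u, u, w} A (MinTensor.{u, u, w} B C))) :=
    isClosed_assocGraph.preimage (F.prodMap G).continuous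
  exact assocGraph_le hc h hz

/-- Naturality of the associator. It moves the coassociativity axiom from `A a`, `A b`, `A c` to the
direct sum. -/
theorem minMap_mem_assocGraph {A' B' C' : Type v} [NonUnitalCStarAlgebra A']
    [NonUnitalCStarAlgebra B'] [NonUnitalCStarAlgebra C'] (f : A →⋆ₙₐ[ℂ] A') (g : B →⋆ₙₐ[ℂ] B')
    (h : C →⋆ₙₐ[ℂ] C') {z} (hz : z ∈ assocGraph.{u, w} A B C) :
    ((minMap (minMap f g : MinTensor.{u, u, w} A B →⋆ₙₐ[ℂ] MinTensor.{v, v, w} A' B') h z.1 :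
        MinTensor.{v, v, w} _ _),
      (minMap f (minMap g h : MinTensor.{u, u, w} B C →⋆ₙₐ[ℂ] MinTensor.{v, v, w} B' C') z.2 :
        MinTensor.{v, v, w} _ _)) ∈ assocGraph.{v, w} A' B' C' := by
  refine mem_assocGraph_of_map
    (homCLM (minMap (minMap f g : MinTensor.{u, u, w} A B →⋆ₙₐ[ℂ] MinTensor.{v, v, w} A' B') h))
    (homCLM (minMap f (minMap g h : MinTensor.{u, u, w} B C →⋆ₙₐ[ℂ] MinTensor.{v, v, w} B' C')))
    (fun a b c => ?_) hz
  simp only [homCLM_apply, minMap_minTmul]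
  exact minTmul_mem_assocGraph _ _ _

/-- Multiplicativity of the associator: corresponding elements act as corresponding multipliers.
Each variable is reduced in turn to simple tensors. -/
theorem mul_mem_assocGraph {y z} (hy : y ∈ assocGraph.{u, w} A B C)
    (hz : z ∈ assocGraph.{u, w} A B C) : (y.1 * z.1, y.2 * z.2) ∈ assocGraph.{u, w} A B C := by
  refine mem_assocGraph_of_map ((ContinuousLinearMap.mul ℂ _).flip z.1)
    ((ContinuousLinearMap.mul ℂ _).flip z.2) (fun a b c => ?_) hy
  refine mem_assocGraph_of_map
    (ContinuousLinearMap.mul ℂ _ (minTmul (minTmul a b) c))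
    (ContinuousLinearMap.mul ℂ _ (minTmul a (minTmul b c))) (fun a' b' c' => ?_) hz
  simp only [ContinuousLinearMap.mul_apply', minTmul_mul_minTmul]
  exact minTmul_mem_assocGraph _ _ _

end AssocGraph

/-! ### Extension to multipliers for homomorphisms into the algebra itself -/

section Bialgebra

open DoubleCentralizer
open scoped MultiplierAlgebra

variable {A : Type u} [NonUnitalCStarAlgebra A] {B : Type v} [NonUnitalCStarAlgebra B]

/-- At an element of `A`, the extension of `f` is just `f`; the defining identity is
multiplicativity. -/
theorem isExtensionAt_coeHom {f : A →⋆ₙₐ[ℂ] B} (hf : IsNondegenerate (coeHom.comp f)) (a : A) :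
    IsExtensionAt (coeHom.comp f) (coeHom (𝕜 := ℂ) a) (coeHom (𝕜 := ℂ) (f a)) :=
  ⟨hf, fun x y => by
    change f a * (f x * y) = f (a * x) * y
    rw [map_mul, mul_assoc]⟩

theorem isNondegenerate_coeHom_comp {f : A →⋆ₙₐ[ℂ] B} :
    IsNondegenerate (coeHom.comp f : A →⋆ₙₐ[ℂ] 𝓜(ℂ, B)) ↔
      Dense (Submodule.span ℂ {z : B | ∃ a b, z = f a * b} : Set B) := Iff.rfl

end Bialgebra

/-! ### Local units for the comultiplication -/

section Comul

open DoubleCentralizer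

variable {M : Type v} {A : M → Type u} [∀ a, CStarAlgebra (A a)]

/-- The elements `x ⊗ y` with `x` in one of the `A b` and `y` in one of the `A c`. -/
theorem dense_span_minTmul_of : Dense (Submodule.span ℂ
    {z : MinTensor.{max u v, max u v, w} (C0Sum A) (C0Sum A) |
      ∃ b c, ∃ (x : A b) (y : A c), z = minTmul (C0Sum.of b x) (C0Sum.of c y)} :
    Set (MinTensor.{max u v, max u v, w} (C0Sum A) (C0Sum A))) := by
  refine (dense_span_minTmul.{max u v, max u v, w} (C0Sum.dense_span_of (A := A))
    (C0Sum.dense_span_of (A := A))).mono (Submodule.span_mono ?_)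
  rintro _ ⟨_, ⟨b, x, rfl⟩, _, ⟨c, y, rfl⟩, rfl⟩
  exact ⟨b, c, x, y, rfl⟩

variable [Monoid M]
  {φ : ∀ a b : M, A (a * b) →⋆ₙₐ[ℂ] MinTensor.{u, u, w} (A a) (A b)}

/-- Among the components of `comul` at the unit of `A (b * c)`, that of `(b, c)` is the unit of `A b
⊗ A c`; the others are orthogonal to this summand. These local units give all the density statements
about `comul`. -/
theorem comul_one_mul (hone : ∀ a b, φ a b 1 = minTmul 1 1)
    (hfin : ∀ a : M, {p : M × M | p.1 * p.2 = a}.Finite) (b c : M) (x : A b) (y : A c) :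
    comul φ hfin (C0Sum.of (b * c) 1) * minTmul (C0Sum.of b x) (C0Sum.of c y) =
      minTmul (C0Sum.of b x) (C0Sum.of c y) := by
  have hxy : (minTmul (C0Sum.of b x) (C0Sum.of c y) :
      MinTensor.{max u v, max u v, w} (C0Sum A) (C0Sum A)) =
      minMap (C0Sum.of b) (C0Sum.of c) (minTmul x y) := (minMap_minTmul _ _ _ _).symm
  rw [comul_of, Finset.sum_mul, Finset.sum_eq_single (b, c)]
  · rw [comulTerm_of_mul, hone, minMap_minTmul, minTmul_mul_minTmul, ← map_mul, ← map_mul,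
      one_mul, one_mul]
  · intro p _ hp
    rw [hxy, comulTerm_apply]
    exact C0Sum.minMap_of_mul_minMap_of (q := (b, c)) hp _ _
  · exact fun h => absurd ((hfin _).mem_toFinset.2 rfl) h

end Comul

/-! ### Nondegeneracy and coassociativity -/

section ComulCoassoc

open DoubleCentralizer

variable {M : Type v} {A : M → Type u} [∀ a, CStarAlgebra (A a)]

theorem C0Sum.of_one_mul (d : M) (x : A d) : C0Sum.of d 1 * C0Sum.of d x = C0Sum.of d x := by
  rw [← map_mul, one_mul]

variable [Monoid M]
  {φ : ∀ a b : M, A (a * b) →⋆ₙₐ[ℂ] MinTensor.{u, u, w} (A a) (A b)}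

theorem dense_span_comul_mul (hone : ∀ a b, φ a b 1 = minTmul 1 1)
    (hfin : ∀ a : M, {p : M × M | p.1 * p.2 = a}.Finite) :
    Dense (Submodule.span ℂ {z | ∃ a b c, z = comul φ hfin a * minTmul b c} :
      Set (MinTensor.{max u v, max u v, w} (C0Sum A) (C0Sum A))) := by
  refine (dense_span_minTmul_of.{u, v, w} (A := A)).mono (Submodule.span_mono ?_)
  rintro _ ⟨b, c, x, y, rfl⟩
  exact ⟨_, _, _, (comul_one_mul hone hfin b c x y).symm⟩

theorem isNondegenerate_comul_id (hone : ∀ a b, φ a b 1 = minTmul 1 1)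
    (hfin : ∀ a : M, {p : M × M | p.1 * p.2 = a}.Finite) :
    IsNondegenerate (coeHom.comp
      (minMap (comul φ hfin) (NonUnitalStarAlgHom.id ℂ (C0Sum A)) :
        MinTensor.{max u v, max u v, w} (C0Sum A) (C0Sum A) →⋆ₙₐ[ℂ] MinTensor.{max u v, max u v, w}
          (MinTensor.{max u v, max u v, w} (C0Sum A) (C0Sum A)) (C0Sum A))) := by
  rw [isNondegenerate_coeHom_comp]
  refine (dense_span_minTmul.{max u v, max u v, w} (dense_span_minTmul_of.{u, v, w} (A := A))
    (C0Sum.dense_span_of (A := A))).mono (Submodule.span_mono ?_)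
  rintro _ ⟨_, ⟨b, c, x, y, rfl⟩, _, ⟨d, t, rfl⟩, rfl⟩
  refine ⟨minTmul (C0Sum.of (b * c) 1) (C0Sum.of d 1),
    minTmul (minTmul (C0Sum.of b x) (C0Sum.of c y)) (C0Sum.of d t), ?_⟩
  rw [minMap_minTmul, minTmul_mul_minTmul, comul_one_mul hone]
  exact congrArg (minTmul _) (C0Sum.of_one_mul d t).symm

theorem isNondegenerate_id_comul (hone : ∀ a b, φ a b 1 = minTmul 1 1)
    (hfin : ∀ a : M, {p : M × M | p.1 * p.2 = a}.Finite) :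
    IsNondegenerate (coeHom.comp
      (minMap (NonUnitalStarAlgHom.id ℂ (C0Sum A)) (comul φ hfin) :
        MinTensor.{max u v, max u v, w} (C0Sum A) (C0Sum A) →⋆ₙₐ[ℂ] MinTensor.{max u v, max u v, w}
          (C0Sum A) (MinTensor.{max u v, max u v, w} (C0Sum A) (C0Sum A)))) := by
  rw [isNondegenerate_coeHom_comp]
  refine (dense_span_minTmul.{max u v, max u v, w} (C0Sum.dense_span_of (A := A))
    (dense_span_minTmul_of.{u, v, w} (A := A))).mono (Submodule.span_mono ?_)
  rintro _ ⟨_, ⟨d, t, rfl⟩, _, ⟨b, c, x, y, rfl⟩, rfl⟩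
  refine ⟨minTmul (C0Sum.of d 1) (C0Sum.of (b * c) 1),
    minTmul (C0Sum.of d t) (minTmul (C0Sum.of b x) (C0Sum.of c y)), ?_⟩
  rw [minMap_minTmul, minTmul_mul_minTmul, comul_one_mul hone]
  exact congrArg (minTmul · _) (C0Sum.of_one_mul d t).symm

variable (φ) in
/-- The component `(φ_{a,b} ⊗ id) φ_{ab,c}` of `(Δ ⊗ id) Δ`. -/
def comulComulTerm (a b c : M) (x : C0Sum A) : MinTensor.{max u v, max u v, w}
    (MinTensor.{max u v, max u v, w} (C0Sum A) (C0Sum A)) (C0Sum A) :=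
  minMap (minMap (C0Sum.of a) (C0Sum.of b) : MinTensor.{u, u, w} (A a) (A b) →⋆ₙₐ[ℂ]
      MinTensor.{max u v, max u v, w} (C0Sum A) (C0Sum A)) (C0Sum.of c)
    (minMap (φ a b) (NonUnitalStarAlgHom.id ℂ (A c)) (φ (a * b) c (C0Sum.proj (a * b * c) x)) :
      MinTensor.{u, u, w} (MinTensor.{u, u, w} (A a) (A b)) (A c))

variable (φ) in
/-- The component `(id ⊗ φ_{b,c}) φ_{a,bc}` of `(id ⊗ Δ) Δ`. -/
def comulComulTerm' (a b c : M) (x : C0Sum A) : MinTensor.{max u v, max u v, w} (C0Sum A)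
    (MinTensor.{max u v, max u v, w} (C0Sum A) (C0Sum A)) :=
  minMap (C0Sum.of a) (minMap (C0Sum.of b) (C0Sum.of c) : MinTensor.{u, u, w} (A b) (A c) →⋆ₙₐ[ℂ]
      MinTensor.{max u v, max u v, w} (C0Sum A) (C0Sum A))
    (minMap (NonUnitalStarAlgHom.id ℂ (A a)) (φ b c) (φ a (b * c) (C0Sum.proj (a * (b * c)) x)) :
      MinTensor.{u, u, w} (A a) (MinTensor.{u, u, w} (A b) (A c)))

theorem comulTerm_comp_of (b c : M) : (comulTerm φ (b, c)).comp (C0Sum.of (b * c)) =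
    (minMap (C0Sum.of b) (C0Sum.of c)).comp (φ b c) :=
  NonUnitalStarAlgHom.ext fun x => comulTerm_of_mul φ b c x

variable (hfin : ∀ a : M, {p : M × M | p.1 * p.2 = a}.Finite)

/-- The first leg of `comulTerm φ p x` lies in `A p.1`, where `comul` is a finite sum over the
factorizations of `p.1`. -/
theorem minMap_comul_id_comulTerm (p : M × M) (x : C0Sum A) :
    (minMap (comul φ hfin) (NonUnitalStarAlgHom.id ℂ (C0Sum A)) (comulTerm φ p x) :
      MinTensor.{max u v, max u v, w}
        (MinTensor.{max u v, max u v, w} (C0Sum A) (C0Sum A)) (C0Sum A)) =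
      ∑ q ∈ (hfin p.1).toFinset, comulComulTerm φ q.1 q.2 p.2 x := by
  obtain ⟨p, c⟩ := p
  rw [comulTerm_apply, minMap_minMap.{u, u, w, max u v, max u v, max u v, max u v},
    minMap_eq_sum_left _ _ (fun q => (comulTerm φ q).comp (C0Sum.of p)) _
      (fun y => comul_of φ hfin p y)]
  refine Finset.sum_congr rfl fun q hq => ?_
  obtain ⟨a, b⟩ := q
  obtain rfl : a * b = p := (hfin p).mem_toFinset.1 hq
  rw [comulTerm_comp_of, comulComulTerm, minMap_minMap.{u, u, w, u, u, max u v, max u v}]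
  rfl

theorem minMap_id_comul_comulTerm (p : M × M) (x : C0Sum A) :
    (minMap (NonUnitalStarAlgHom.id ℂ (C0Sum A)) (comul φ hfin) (comulTerm φ p x) :
      MinTensor.{max u v, max u v, w} (C0Sum A)
        (MinTensor.{max u v, max u v, w} (C0Sum A) (C0Sum A))) =
      ∑ q ∈ (hfin p.2).toFinset, comulComulTerm' φ p.1 q.1 q.2 x := by
  obtain ⟨a, p⟩ := p
  rw [comulTerm_apply, minMap_minMap.{u, u, w, max u v, max u v, max u v, max u v},
    minMap_eq_sum_right _ _ _ (fun q => (comulTerm φ q).comp (C0Sum.of p))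
      (fun y => comul_of φ hfin p y)]
  refine Finset.sum_congr rfl fun q hq => ?_
  obtain ⟨b, c⟩ := q
  obtain rfl : b * c = p := (hfin p).mem_toFinset.1 hq
  rw [comulTerm_comp_of, comulComulTerm', minMap_minMap.{u, u, w, u, u, max u v, max u v}]
  rfl

/-- Summation over the factorizations `d = a b c`, grouped in either way. -/
theorem sum_factorizations_assoc {E : Type*} [AddCommMonoid E] (f : M → M → M → E) (d : M) :
    ∑ p ∈ (hfin d).toFinset, ∑ q ∈ (hfin p.1).toFinset, f q.1 q.2 p.2 =
      ∑ p ∈ (hfin d).toFinset, ∑ q ∈ (hfin p.2).toFinset, f p.1 q.1 q.2 := by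
  rw [Finset.sum_sigma', Finset.sum_sigma']
  -- The bijection matches `((a * b, c), (a, b))` with `((a, b * c), (b, c))`.
  refine Finset.sum_nbij' (fun z => ⟨(z.2.1, z.2.2 * z.1.2), (z.2.2, z.1.2)⟩)
    (fun z => ⟨(z.1.1 * z.2.1, z.2.2), (z.1.1, z.2.1)⟩) ?_ ?_ ?_ ?_ ?_
  all_goals
    rintro ⟨⟨p, c⟩, ⟨a, b⟩⟩ h
    simp only [Finset.mem_sigma, Set.Finite.mem_toFinset, Set.mem_ofPred_eq] at h ⊢
  · rw [← h.1, ← h.2, mul_assoc]; exact ⟨rfl, trivial⟩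
  · rw [← h.1, ← h.2, mul_assoc]; exact ⟨rfl, trivial⟩
  · rw [h.2]
  · rw [h.2]

theorem comul_coassoc_of {ε : A 1 →⋆ₙₐ[ℂ] ℂ} (hφ : IsCStarWCS φ ε) (d : M) (x : A d) :
    ((minMap (comul φ hfin) (NonUnitalStarAlgHom.id ℂ (C0Sum A))
        (comul φ hfin (C0Sum.of d x)) : MinTensor.{max u v, max u v, w} _ _),
      (minMap (NonUnitalStarAlgHom.id ℂ (C0Sum A)) (comul φ hfin)
        (comul φ hfin (C0Sum.of d x)) : MinTensor.{max u v, max u v, w} _ _)) ∈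
      assocGraph.{max u v, w} (C0Sum A) (C0Sum A) (C0Sum A) := by
  have hl : ∀ a b c y, (comulComulTerm φ a b c y, comulComulTerm' φ a b c y) ∈
      assocGraph.{max u v, w} (C0Sum A) (C0Sum A) (C0Sum A) := fun a b c y => by
    have h := hφ.coassoc a b c (C0Sum.proj (a * b * c) y)
    rw [C0Sum.castHom_proj] at h
    have h' := minMap_mem_assocGraph.{u, max u v, w} (C0Sum.of a) (C0Sum.of b) (C0Sum.of c) h
    exact h'
  rw [comul_of, map_sum, map_sum]
  simp only [minMap_comul_id_comulTerm, minMap_id_comul_comulTerm]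
  -- With both double sums indexed alike, the pair of sums is a sum of pairs, each in the graph by
  -- `hl`.
  rw [← sum_factorizations_assoc hfin (fun a b c => comulComulTerm' φ a b c (C0Sum.of d x))]
  have h := Submodule.sum_mem (assocGraph.{max u v, w} (C0Sum A) (C0Sum A) (C0Sum A))
    (t := (hfin d).toFinset) fun p _ => Submodule.sum_mem _ (t := (hfin p.1).toFinset)
      fun q _ => hl q.1 q.2 p.2 (C0Sum.of d x)
  convert h using 1
  simp only [Prod.ext_iff, Prod.fst_sum, Prod.snd_sum, and_self]

/-- The elements `x` with this property form a closed subspace, the preimage of the graph under a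
continuous linear map, and it contains every `A d`. -/
theorem comul_coassoc {ε : A 1 →⋆ₙₐ[ℂ] ℂ} (hφ : IsCStarWCS φ ε) (x : C0Sum A) :
    ((minMap (comul φ hfin) (NonUnitalStarAlgHom.id ℂ (C0Sum A))
        (comul φ hfin x) : MinTensor.{max u v, max u v, w} _ _),
      (minMap (NonUnitalStarAlgHom.id ℂ (C0Sum A)) (comul φ hfin)
        (comul φ hfin x) : MinTensor.{max u v, max u v, w} _ _)) ∈
      assocGraph.{max u v, w} (C0Sum A) (C0Sum A) (C0Sum A) := by
  have hc := isClosed_assocGraph.{max u v, w} (A := C0Sum A) (B := C0Sum A) (C := C0Sum A)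
  set L : C0Sum A →L[ℂ] _ := ((homCLM (minMap (comul φ hfin)
    (NonUnitalStarAlgHom.id ℂ (C0Sum A)))).comp (homCLM (comul φ hfin))).prod
    ((homCLM (minMap (NonUnitalStarAlgHom.id ℂ (C0Sum A)) (comul φ hfin))).comp
      (homCLM (comul φ hfin))) with hL
  refine mem_of_dense_span C0Sum.dense_span_of
    ((assocGraph.{max u v, w} (C0Sum A) (C0Sum A) (C0Sum A)).comap L.toLinearMap)
    (hc.preimage L.continuous) ?_ x
  rintro _ ⟨d, x, rfl⟩
  exact comul_coassoc_of hfin hφ d x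

theorem isCStarBialgebra_comul {ε : A 1 →⋆ₙₐ[ℂ] ℂ} (hφ : IsCStarWCS φ ε) :
    IsCStarBialgebra.{max u v, w} (coeHom.comp (comul φ hfin)) where
  dense_span := dense_span_comul_mul hφ.map_one hfin
  coassoc := by
    refine ⟨coeHom.comp (minMap (comul φ hfin) (NonUnitalStarAlgHom.id ℂ (C0Sum A))),
      coeHom.comp (minMap (NonUnitalStarAlgHom.id ℂ (C0Sum A)) (comul φ hfin)), ?_, ?_,
      fun a => ⟨_, _, isExtensionAt_coeHom (isNondegenerate_comul_id hφ.map_one hfin) _,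
        isExtensionAt_coeHom (isNondegenerate_id_comul hφ.map_one hfin) _,
        fun z hz => ?_⟩⟩
    · intro a₁ a₂ b₁ b₂
      change minMap _ _ (minTmul a₁ a₂) * _ = _
      rw [minMap_minTmul, minTmul_mul_minTmul]
      rfl
    · intro a₁ a₂ b₁ b₂
      change minMap _ _ (minTmul a₁ a₂) * _ = _
      rw [minMap_minTmul, minTmul_mul_minTmul]
      rfl
    -- Both multipliers are left multiplications by elements that correspond under the associator.
    · have h := mul_mem_assocGraph.{max u v, w} (comul_coassoc hfin hφ a) hz
      exact h

end ComulCoassoc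

/-! ### The counit -/

section ComulCounit

open DoubleCentralizer

variable {M : Type v} {A : M → Type u} [∀ a, CStarAlgebra (A a)] [Monoid M]
  {φ : ∀ a b : M, A (a * b) →⋆ₙₐ[ℂ] MinTensor.{u, u, w} (A a) (A b)}
  {ε : A 1 →⋆ₙₐ[ℂ] ℂ}

/-- `(ε ⊗ id) ∘ (ι ⊗ ι) ∘ φ_{1,d} = 1 ⊗ ι`, where `ι` denotes the embeddings in `⊕ₐ A a`. -/
theorem counit_id_minMap_of (hφ : IsCStarWCS φ ε) (d : M) (x : A d) :
    (minMap (ε.comp (C0Sum.proj 1)) (NonUnitalStarAlgHom.id ℂ (C0Sum A))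
      (minMap (C0Sum.of 1) (C0Sum.of d) (φ 1 d (castHom (one_mul d).symm x)) :
        MinTensor.{max u v, max u v, w} (C0Sum A) (C0Sum A)) :
        MinTensor.{0, max u v, w} ℂ (C0Sum A)) = minTmul 1 (C0Sum.of d x) := by
  -- Push the counit axiom forward along `id ⊗ ι`; both routes then compose to `ε ⊗ ι` applied to `φ
  -- 1 d`.
  have h := congrArg (minMap (NonUnitalStarAlgHom.id ℂ ℂ) (C0Sum.of d) :
    MinTensor.{0, u, w} ℂ (A d) → MinTensor.{0, max u v, w} ℂ (C0Sum A)) (hφ.counit_left d x)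
  rw [minMap_minTmul, minMap_minMap.{u, u, w, 0, u, 0, max u v}] at h
  rw [minMap_minMap.{u, u, w, max u v, max u v, 0, max u v}, NonUnitalStarAlgHom.comp_assoc,
    C0Sum.proj_of_comp_self]
  exact h

theorem id_counit_minMap_of (hφ : IsCStarWCS φ ε) (d : M) (x : A d) :
    (minMap (NonUnitalStarAlgHom.id ℂ (C0Sum A)) (ε.comp (C0Sum.proj 1))
      (minMap (C0Sum.of d) (C0Sum.of 1) (φ d 1 (castHom (mul_one d).symm x)) :
        MinTensor.{max u v, max u v, w} (C0Sum A) (C0Sum A)) :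
        MinTensor.{max u v, 0, w} (C0Sum A) ℂ) = minTmul (C0Sum.of d x) 1 := by
  have h := congrArg (minMap (C0Sum.of d) (NonUnitalStarAlgHom.id ℂ ℂ) :
    MinTensor.{u, 0, w} (A d) ℂ → MinTensor.{max u v, 0, w} (C0Sum A) ℂ) (hφ.counit_right d x)
  rw [minMap_minTmul, minMap_minMap.{u, u, w, u, 0, max u v, 0}] at h
  rw [minMap_minMap.{u, u, w, max u v, max u v, max u v, 0}, NonUnitalStarAlgHom.comp_assoc,
    C0Sum.proj_of_comp_self]
  exact h

/-- The first leg lies in `A p.1`, on which the counit of the direct sum vanishes. -/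
theorem counit_id_comulTerm_of_ne {p : M × M} (hp : p.1 ≠ 1) (x : C0Sum A) :
    (minMap (ε.comp (C0Sum.proj 1)) (NonUnitalStarAlgHom.id ℂ (C0Sum A)) (comulTerm φ p x) :
        MinTensor.{0, max u v, w} ℂ (C0Sum A)) = 0 := by
  have h : (ε.comp (C0Sum.proj 1)).comp (C0Sum.of p.1) = 0 := NonUnitalStarAlgHom.ext fun y =>
    (congrArg ε (C0Sum.proj_of_ne hp.symm y)).trans (map_zero ε)
  rw [comulTerm_apply, minMap_minMap.{u, u, w, max u v, max u v, 0, max u v}, h, minMap_zero_left]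

theorem id_counit_comulTerm_of_ne {p : M × M} (hp : p.2 ≠ 1) (x : C0Sum A) :
    (minMap (NonUnitalStarAlgHom.id ℂ (C0Sum A)) (ε.comp (C0Sum.proj 1)) (comulTerm φ p x) :
        MinTensor.{max u v, 0, w} (C0Sum A) ℂ) = 0 := by
  have h : (ε.comp (C0Sum.proj 1)).comp (C0Sum.of p.2) = 0 := NonUnitalStarAlgHom.ext fun y =>
    (congrArg ε (C0Sum.proj_of_ne hp.symm y)).trans (map_zero ε)
  rw [comulTerm_apply, minMap_minMap.{u, u, w, max u v, max u v, max u v, 0}, h, minMap_zero_right]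

variable (hfin : ∀ a : M, {p : M × M | p.1 * p.2 = a}.Finite)

theorem counit_id_comul (hφ : IsCStarWCS φ ε) (x : C0Sum A) :
    (minMap (ε.comp (C0Sum.proj 1)) (NonUnitalStarAlgHom.id ℂ (C0Sum A)) (comul φ hfin x) :
        MinTensor.{0, max u v, w} ℂ (C0Sum A)) = minTmul 1 x := by
  have key : (homCLM (minMap (ε.comp (C0Sum.proj 1)) (NonUnitalStarAlgHom.id ℂ (C0Sum A)) :
      MinTensor.{max u v, max u v, w} (C0Sum A) (C0Sum A) →⋆ₙₐ[ℂ]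
        MinTensor.{0, max u v, w} ℂ (C0Sum A))).comp (homCLM (comul φ hfin)) =
      minTmulL.{0, max u v, w} (1 : ℂ) := by
    refine eq_of_dense_span C0Sum.dense_span_of fun z hz => ?_
    obtain ⟨d, x, rfl⟩ := hz
    rw [ContinuousLinearMap.comp_apply, homCLM_apply, homCLM_apply, minTmulL_apply, comul_of,
      map_sum, Finset.sum_eq_single (1, d)]
    · rw [← counit_id_minMap_of hφ d x, comulTerm_apply]
      dsimp only
      rw [← C0Sum.castHom_proj (one_mul d).symm, C0Sum.proj_of_self]
    · intro p hp hne
      -- The only factorization of `d` with first factor `1` is `(1, d)`.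
      refine counit_id_comulTerm_of_ne (fun h1 => hne ?_) _
      have h : p.1 * p.2 = d := (hfin d).mem_toFinset.1 hp
      rw [h1, one_mul] at h
      exact Prod.ext h1 h
    · exact fun h => absurd ((hfin d).mem_toFinset.2 (one_mul d)) h
  exact DFunLike.congr_fun key x

theorem id_counit_comul (hφ : IsCStarWCS φ ε) (x : C0Sum A) :
    (minMap (NonUnitalStarAlgHom.id ℂ (C0Sum A)) (ε.comp (C0Sum.proj 1)) (comul φ hfin x) :
        MinTensor.{max u v, 0, w} (C0Sum A) ℂ) = minTmul x 1 := by
  have key : (homCLM (minMap (NonUnitalStarAlgHom.id ℂ (C0Sum A)) (ε.comp (C0Sum.proj 1)) :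
      MinTensor.{max u v, max u v, w} (C0Sum A) (C0Sum A) →⋆ₙₐ[ℂ]
        MinTensor.{max u v, 0, w} (C0Sum A) ℂ)).comp (homCLM (comul φ hfin)) =
      minTmulL.{max u v, 0, w}.flip (1 : ℂ) := by
    refine eq_of_dense_span C0Sum.dense_span_of fun z hz => ?_
    obtain ⟨d, x, rfl⟩ := hz
    rw [ContinuousLinearMap.comp_apply, homCLM_apply, homCLM_apply, minTmulL_flip_apply, comul_of,
      map_sum, Finset.sum_eq_single (d, 1)]
    · rw [← id_counit_minMap_of hφ d x, comulTerm_apply]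
      dsimp only
      rw [← C0Sum.castHom_proj (mul_one d).symm, C0Sum.proj_of_self]
    · intro p hp hne
      refine id_counit_comulTerm_of_ne (fun h1 => hne ?_) _
      have h : p.1 * p.2 = d := (hfin d).mem_toFinset.1 hp
      rw [h1, mul_one] at h
      exact Prod.ext h h1
    · exact fun h => absurd ((hfin d).mem_toFinset.2 (mul_one d)) h
  exact DFunLike.congr_fun key x

theorem dense_span_one : Dense (Submodule.span ℂ {(1 : ℂ)} : Set ℂ) := by
  have h : Submodule.span ℂ {(1 : ℂ)} = ⊤ := Ideal.span_singleton_one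
  rw [h]
  exact dense_univ

/-- By the counit axiom, the embedded `φ 1 d 1` is sent to `1 ⊗ 1`, with the second `1` the unit of
`A d`; it acts as the identity on `ℂ ⊗ A d`. -/
theorem isNondegenerate_counit_id (hφ : IsCStarWCS φ ε) :
    IsNondegenerate (coeHom.comp
      (minMap (ε.comp (C0Sum.proj 1)) (NonUnitalStarAlgHom.id ℂ (C0Sum A)) :
        MinTensor.{max u v, max u v, w} (C0Sum A) (C0Sum A) →⋆ₙₐ[ℂ]
          MinTensor.{0, max u v, w} ℂ (C0Sum A))) := by
  rw [isNondegenerate_coeHom_comp]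
  refine (dense_span_minTmul.{0, max u v, w} dense_span_one
    (C0Sum.dense_span_of (A := A))).mono (Submodule.span_mono ?_)
  rintro _ ⟨_, rfl, _, ⟨d, x, rfl⟩, rfl⟩
  refine ⟨minMap (C0Sum.of 1) (C0Sum.of d) (φ 1 d (castHom (one_mul d).symm 1)),
    minTmul 1 (C0Sum.of d x), ?_⟩
  rw [counit_id_minMap_of hφ d 1, minTmul_mul_minTmul, C0Sum.of_one_mul, one_mul]

theorem isNondegenerate_id_counit (hφ : IsCStarWCS φ ε) :
    IsNondegenerate (coeHom.comp
      (minMap (NonUnitalStarAlgHom.id ℂ (C0Sum A)) (ε.comp (C0Sum.proj 1)) :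
        MinTensor.{max u v, max u v, w} (C0Sum A) (C0Sum A) →⋆ₙₐ[ℂ]
          MinTensor.{max u v, 0, w} (C0Sum A) ℂ)) := by
  rw [isNondegenerate_coeHom_comp]
  refine (dense_span_minTmul.{max u v, 0, w} (C0Sum.dense_span_of (A := A))
    dense_span_one).mono (Submodule.span_mono ?_)
  rintro _ ⟨_, ⟨d, x, rfl⟩, _, rfl, rfl⟩
  refine ⟨minMap (C0Sum.of d) (C0Sum.of 1) (φ d 1 (castHom (mul_one d).symm 1)),
    minTmul (C0Sum.of d x) 1, ?_⟩
  rw [id_counit_minMap_of hφ d 1, minTmul_mul_minTmul, C0Sum.of_one_mul, one_mul]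

theorem isCounit_comul (hφ : IsCStarWCS φ ε) :
    IsCounit.{max u v, w} (coeHom.comp (comul φ hfin)) (ε.comp (C0Sum.proj 1)) where
  left a := by
    -- Writing `1 ⊗ a` as the value of `ε ⊗ id` at `comul` of `a` makes it the extension at an
    -- element of the algebra.
    rw [← counit_id_comul hfin hφ a]
    exact isExtensionAt_coeHom (isNondegenerate_counit_id hφ) _
  right a := by
    rw [← id_counit_comul hfin hφ a]
    exact isExtensionAt_coeHom (isNondegenerate_id_counit hφ) _

end ComulCounit

end

/-- `C0Sum A` is `⊕ₐ A a`; the counit is `ε₁` on `A 1` and `0` on the other `A a`. -/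
theorem theorem2p1 {M : Type v} [Monoid M] (A : M → Type u) [∀ a, CStarAlgebra (A a)]
    (φ : ∀ a b : M, A (a * b) →⋆ₙₐ[ℂ] MinTensor.{u, u, max u v} (A a) (A b))
    (ε₁ : A 1 →⋆ₙₐ[ℂ] ℂ) (hφ : IsCStarWCS φ ε₁)
    (hfin : ∀ a : M, {p : M × M | p.1 * p.2 = a}.Finite) :
    ∃ Δ : C0Sum A →⋆ₙₐ[ℂ] MinTensor.{max u v, max u v, max u v} (C0Sum A) (C0Sum A),
      (IsDirectSumComul φ Δ ∧ ∀ Δ', IsDirectSumComul φ Δ' → Δ' = Δ) ∧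
      IsCStarBialgebra (DoubleCentralizer.coeHom.comp Δ) ∧
      IsStrictlyProper (DoubleCentralizer.coeHom.comp Δ) ∧
      IsCounit (DoubleCentralizer.coeHom.comp Δ) (ε₁.comp (C0Sum.proj 1)) := by
  -- Strict properness holds by `rfl`, since `comul` takes values in the tensor product by
  -- construction.
  refine ⟨comul φ hfin, ⟨isDirectSumComul_comul φ hfin, fun Δ' h => ?_⟩,
    isCStarBialgebra_comul hfin hφ, fun a => ⟨_, rfl⟩, isCounit_comul hfin hφ⟩
  exact h.eq (isDirectSumComul_comul φ hfin)
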